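/- **Setting.** Let $M=\langle\mathcal S,\mathcal A,P,R,\gamma,\rho\rangle$ be a Markov decision process with a measurable state space $\mathcal S$ carrying a $\sigma$-finite reference measure, a discrete (finite or countable) action space $\mathcal A$, transition kernel $P$, reward kernel $R$ with mean $r(s,a)$, discount $\gamma\in[0,1)$ and initial distribution $\rho$. Rewards lie in $[0,V_{\max}]$ almost surely, and $Q^\pi(s,a)\in[0,V_{\max}]$ for every policy $\pi:\mathcal S\to\Delta(\mathcal A)$, where $Q^\pi(s,a)$ is the expected discounted sum of rewards started at $(s,a)$ and following $\pi$ afterwards; $v^\pi$ is the expected discounted sum of rewards of $\pi$ from $s_0\sim\rho$. Let $\eta^\pi_h$ be the law of $(s_h,a_h)$ under $\pi$ with $s_0\sim\rho$, and $\eta^\pi=(1-\gamma)\sum_{h\ge0}\gamma^h\eta^\pi_h$. Densities on $\mathcal S\times\mathcal A$ are with respect to the product of the reference measure and counting measure. Let $\mu$ be a probability distribution on $\mathcal S\times\mathcal A$, and let $D=\{(s_i,a_i,r_i,s'_i)\}_{i=1}^n$, $n\ge1$, be i.i.d. with $(s_i,a_i)\sim\mu$, $r_i\sim R(s_i,a_i)$,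 $s'_i\sim P(s_i,a_i)$. Let $\widehat\mu$ be a (possibly random) probability density on $\mathcal S\times\mathcal A$, independent of $D$. For a threshold $b>0$ put $\zeta(s,a)=\mathbf 1(\widehat\mu(s,a)\ge b)$ and, for $f:\mathcal S\times\mathcal A\to\mathbb R$, $$(\widetilde{\mathcal T}f)(s,a)=r(s,a)+\gamma\,\mathbb E_{s'\sim P(s,a)}\Big[\max_{a'}\zeta(s',a')f(s',a')\Big].$$ Let $\mathcal F$ be a finite class of measurable functions $\mathcal S\times\mathcal A\to[0,V_{\max}]$. MBS-QI starts from some $f_0\in\mathcal F$ and iterates $$f_{t+1}\in\arg\min_{f\in\mathcal F}\frac1n\sum_{i=1}^n\Big(f(s_i,a_i)-r_i-\gamma\max_{a'}\zeta(s'_i,a')f_t(s'_i,a')\Big)^2,\qquad \widehat\pi_{t+1}(s)\in\arg\max_{a}\zeta(s,a)f_{t+1}(s,a).$$ Let $\Pi_C^{all}$ be the set of policies $\pi:\mathcal S\to\Delta(\mathcal A)$ with $\Pr_{(s,a)\sim\eta^\pi}(\zeta(s,a)=0)\le\epsilon_\zeta$. Write $\|g\|_{2,\mu}=(\mathbb E_\mu[g^2])^{1/2}$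 and $\|\nu-\nu'\|_{TV}=\sup_B|\nu(B)-\nu'(B)|$. **Theorem 2.** There is a universal constant $c>0$ such that the following holds. Let $0<\delta<1$ and assume: 1. (bounded densities) for every non-stationary policy $\pi$ and every $h\ge0$, $\eta^\pi_h$ has a density bounded by $U$; 2. (density estimation error) with probability at least $1-\delta$, $\|\widehat\mu-\mu\|_{TV}\le\epsilon_\mu$; 3. (completeness under $\widetilde{\mathcal T}$) $\max_{f\in\mathcal F}\min_{g\in\mathcal F}\|g-\widetilde{\mathcal T}f\|_{2,\mu}^2\le\epsilon'_{\mathcal F}$ (almost surely, if $\widehat\mu$ is random). Put $C=U/b$. Then, with probability at least $1-2\delta$, for every $t\ge1$, every output $\widehat\pi_t$ of $t$ iterations of MBS-QI (as a measurable function of the state) and every $\widetilde\pi\in\Pi_C^{all}$, $$v^{\widetilde\pi}-v^{\widehat\pi_t}\le\frac{2C}{(1-\gamma)^2}\left(c\sqrt{\frac{V_{\max}^2\ln(|\mathcal F|/\delta)}{n}}+\sqrt{\epsilon'_{\mathcal F}}+V_{\max}\epsilon_\mu+\big\|Q^{\widetilde\pi}-\widetilde{\mathcal T}Q^{\widetilde\pi}\big\|_{2,\mu}\right)+\frac{(2\gamma^t+\epsilon_\zeta)V_{\max}}{1-\gamma}.$$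 -/

import Mathlib

open MeasureTheory ProbabilityTheory

noncomputable section

namespace MBS

/-- A Markov decision process with state space `S` and action space `A`: transition kernel `P`,
reward kernel `R` (a distribution of real rewards for every state-action pair), initial state
distribution `ρ` and discount factor `γ ∈ [0, 1)`. -/
structure MDP (S A : Type*) [MeasurableSpace S] [MeasurableSpace A] where
  P : Kernel (S × A) S
  R : Kernel (S × A) ℝ
  ρ : Measure S
  γ : ℝ
  markov_P : IsMarkovKernel P
  markov_R : IsMarkovKernel R
  prob_ρ : IsProbabilityMeasure ρ
  γ_nonneg : 0 ≤ γ
  γ_lt_one : γ < 1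

attribute [instance] MDP.markov_P MDP.markov_R MDP.prob_ρ

/-- A (stationary, randomized) policy `S → Δ(A)`. A non-stationary policy is a sequence
`ℕ → Policy S A`. -/
structure Policy (S A : Type*) [MeasurableSpace S] [MeasurableSpace A] where
  kernel : Kernel S A
  markov : IsMarkovKernel kernel

attribute [instance] Policy.markov

/-- The deterministic policy that plays `g s` in state `s`. -/
def Policy.ofFun {S A : Type*} [MeasurableSpace S] [MeasurableSpace A]
    (g : S → A) (hg : Measurable g) : Policy S A where
  kernel := Kernel.deterministic g hg
  markov := inferInstance

namespace MDP

variable {S A : Type*} [MeasurableSpace S] [MeasurableSpace A] (M : MDP S A)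

/-- The mean reward `r(s, a)`. -/
def meanReward (x : S × A) : ℝ := ∫ r, r ∂(M.R x)

/-- Law of `(s_h, a_h)` given `s_0 = s`, when `a_i ∼ π_i(s_i)` and `s_{i+1} ∼ P(s_i, a_i)`. -/
def lawFromState (π : ℕ → Policy S A) : ℕ → Kernel S (S × A)
  | 0 => Kernel.id ×ₖ (π 0).kernel
  | h + 1 => (Kernel.id ×ₖ (π (h + 1)).kernel) ∘ₖ (M.P ∘ₖ lawFromState π h)

/-- Law of `(s_h, a_h)` given `(s_0, a_0) = (s, a)`, when the policy `π` is followed from time `1`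
on. -/
def lawFromPair (π : Policy S A) : ℕ → Kernel (S × A) (S × A)
  | 0 => Kernel.id
  | h + 1 => M.lawFromState (fun _ => π) h ∘ₖ M.P

/-- The marginal law `η_h^π` of `(s_h, a_h)` with `s_0 ∼ ρ`. -/
def η (π : ℕ → Policy S A) (h : ℕ) : Measure (S × A) := M.ρ.bind (M.lawFromState π h)

/-- The discounted occupancy measure `η^π = (1 - γ) ∑ₕ γ^h η_h^π`. -/
def occupancy (π : Policy S A) : Measure (S × A) :=
  Measure.sum fun h : ℕ => ENNReal.ofReal ((1 - M.γ) * M.γ ^ h) • M.η (fun _ => π) h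

/-- `V^π(s)`, the expected discounted sum of rewards from state `s`. -/
def V (π : Policy S A) (s : S) : ℝ :=
  ∑' h : ℕ, M.γ ^ h * ∫ x, M.meanReward x ∂(M.lawFromState (fun _ => π) h s)

/-- `Q^π(s, a)`, the expected discounted sum of rewards from state `s` with first action `a`. -/
def Q (π : Policy S A) (x : S × A) : ℝ :=
  ∑' h : ℕ, M.γ ^ h * ∫ y, M.meanReward y ∂(M.lawFromPair π h x)

/-- `v^π`, the expectation of `V^π` under the initial state distribution. -/
def value (π : Policy S A) : ℝ := ∫ s, M.V π s ∂M.ρ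

/-- Rewards lie in `[0, Vmax]` almost surely and `Q^π(s, a) ∈ [0, Vmax]` for every policy. -/
def ValuesBoundedBy (Vmax : ℝ) : Prop :=
  (∀ x, ∀ᵐ r ∂(M.R x), r ∈ Set.Icc 0 Vmax) ∧
    ∀ (π : Policy S A) (x : S × A), M.Q π x ∈ Set.Icc 0 Vmax

/-- Bounded densities: with respect to the product of the reference measure `lam` on states and
counting measure on actions, every `η_h^π`, for every non-stationary policy `π`, has a density
that is at most `U`. -/
def BoundedDensities (lam : Measure S) (U : ℝ) : Prop :=
  ∀ (π : ℕ → Policy S A) (h : ℕ),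
    M.η π h ≤ ENNReal.ofReal U • lam.prod (Measure.count : Measure A)

/-- The law of one data point `((s, a), (r, s'))`: `(s, a) ∼ μ`, `r ∼ R(s, a)`, `s' ∼ P(s, a)`. -/
def dataLaw (μ : Measure (S × A)) : Measure ((S × A) × (ℝ × S)) := μ.compProd (M.R ×ₖ M.P)

/-- The `ζ`-constrained Bellman optimality operator
`(T f)(s, a) = r(s, a) + γ E_{s'} [max_{a'} ζ(s', a') f(s', a')]`. -/
def bellman (ζ : S × A → ℝ) (f : S × A → ℝ) (x : S × A) : ℝ :=
  M.meanReward x + M.γ * ∫ s', (⨆ a' : A, ζ (s', a') * f (s', a')) ∂(M.P x)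

/-- The empirical loss `L_D(f; f')`. -/
def empLoss {n : ℕ} (D : Fin n → (S × A) × (ℝ × S)) (ζ : S × A → ℝ) (f f' : S × A → ℝ) : ℝ :=
  (∑ i, (f (D i).1 - (D i).2.1 -
    M.γ * ⨆ a' : A, ζ ((D i).2.2, a') * f' ((D i).2.2, a')) ^ 2) / n

/-- `f` and `πhat` are the iterates of a run of `T` iterations of MBS `Q`-iteration on the data
`D`, with function class `F` and filter `ζ`, started at some `f 0 ∈ F`. Ties in the argmin and
the argmax may be broken in any way. -/
structure IsMBSQIRun {n : ℕ} (D : Fin n → (S × A) × (ℝ × S)) (F : Finset (S × A → ℝ))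
    (ζ : S × A → ℝ) (T : ℕ) (f : ℕ → S × A → ℝ) (πhat : ℕ → S → A) : Prop where
  init : f 0 ∈ F
  mem : ∀ t < T, f (t + 1) ∈ F
  argmin : ∀ t < T, ∀ g ∈ F, M.empLoss D ζ (f (t + 1)) (f t) ≤ M.empLoss D ζ g (f t)
  argmax : ∀ t < T, ∀ s a,
    ζ (s, a) * f (t + 1) (s, a) ≤ ζ (s, πhat (t + 1) s) * f (t + 1) (s, πhat (t + 1) s)

/-- The `ζ`-constrained policy set: policies with `Pr(ζ(s, a) = 0 | π) ≤ εζ`. -/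
def constrainedPolicies (ζ : S × A → ℝ) (εζ : ℝ) : Set (Policy S A) :=
  {π | (M.occupancy π).real {x | ζ x = 0} ≤ εζ}

end MDP

/-- The filter `ζ(s, a) = 1(μhat(s, a) ≥ b)`. -/
def filter {X : Type*} (μhat : X → ℝ) (b : ℝ) (x : X) : ℝ :=
  Set.indicator {x | b ≤ μhat x} 1 x

/-- The probability measure with density `p` with respect to `m`. -/
def densityMeasure {X : Type*} [MeasurableSpace X] (m : Measure X) (p : X → ℝ) : Measure X :=
  m.withDensity fun x => ENNReal.ofReal (p x)

/-- Nonnegative functions with integral one with respect to `m`. -/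
def IsDensity {X : Type*} [MeasurableSpace X] (m : Measure X) (p : X → ℝ) : Prop :=
  (∀ x, 0 ≤ p x) ∧ IsProbabilityMeasure (densityMeasure m p)

/-- Total variation distance of probability measures, `sup_B |μ(B) - ν(B)|`. -/
def tvDist {X : Type*} [MeasurableSpace X] (μ ν : Measure X) : ℝ :=
  ⨆ B : {B : Set X // MeasurableSet B}, |μ.real B - ν.real B|

/-- The norm `‖g‖_{2,μ}`. -/
def l2norm {X : Type*} [MeasurableSpace X] (μ : Measure X) (g : X → ℝ) : ℝ :=
  √(∫ x, g x ^ 2 ∂μ)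

/-- The event `E` has probability at least `p` (it contains a measurable set that does). -/
def WithProbAtLeast {Ω : Type*} [MeasurableSpace Ω] (Pr : Measure Ω) (p : ℝ) (E : Set Ω) : Prop :=
  ∃ G ⊆ E, MeasurableSet G ∧ ENNReal.ofReal p ≤ Pr G

end MBS

end

/-! On pairs kept by the filter the estimated density is at least `b`, so every reachable law with
density at most `U` is dominated there by `U / b` times the estimate. Passing from the estimate to
`μ` costs `Vmax * εμ` for `[0, Vmax]`-valued functions. Filtered expectations along any
non-stationary policy are therefore at most `C` times expectations under `μ` plus this error. This
is `ConcentrateOn`, proved in `concentrateOn_filter`, and it is the only change of measure in the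
argument.

The comparator enters through `g = Q^π̃`, an approximate fixed point of the filtered Bellman
operator with defect measured under `μ`. The filtered distance between the iterate `f k` and `g`
obeys a recursion with factor `γ`, driven by the regression errors, the defect of `g` and the
density error (`integral_maxValue_abs_sub_le`). A second recursion, along the trajectory of the
output policy, bounds the gap between the filtered greedy value of `g` and the value of that policy
(`integral_maxValue_sub_V_le`). Each recursion contributes one factor `1 / (1 - γ)`. The filtered
greedy value of `Q^π̃` falls short of the value of `π̃` only through initial pairs that are filtered
out, whose mass is at most `εζ / (1 - γ)` (`value_le_integral_maxValue`).

For the regression errors, the difference of two squared losses has as mean the difference of the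
two squared Bellman errors, and its second moment is controlled by the square of their sum. A
Chernoff bound thus compares the unsquared errors at scale `Vmax * √(log q / n)`
(`measure_sum_lossDiff_nonpos_le`). A union bound over all triples from `F` (candidate, competitor,
function defining the target) makes the comparison uniform, which covers every iteration and every
tie-break although the iterates depend on the data. The filter is random but independent of the
data, so it is held fixed in this estimate and integrated out by Fubini
(`measure_compl_wellRanked_le`). -/

namespace MBS

/-! ### Bounded integrals, total variation, measurable selection and a Chernoff bound. -/

section Generic

variable {X Y : Type*} [MeasurableSpace X] [MeasurableSpace Y]

lemma integrable_of_abs_le {ν : Measure X} [IsFiniteMeasure ν] {f : X → ℝ} (hf : Measurable f)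
    {K : ℝ} (hK : ∀ x, |f x| ≤ K) : Integrable f ν :=
  Integrable.of_bound hf.aestronglyMeasurable K (Filter.Eventually.of_forall hK)

lemma abs_le_of_mem_Icc {V x : ℝ} (hx : x ∈ Set.Icc 0 V) : |x| ≤ V := by
  rw [abs_of_nonneg hx.1]; exact hx.2

lemma integrable_of_mem_Icc {ν : Measure X} [IsFiniteMeasure ν] {f : X → ℝ} (hf : Measurable f)
    {V : ℝ} (hV : ∀ x, f x ∈ Set.Icc 0 V) : Integrable f ν :=
  integrable_of_abs_le hf fun x => abs_le_of_mem_Icc (hV x)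

lemma integral_mem_Icc {ν : Measure X} [IsProbabilityMeasure ν] {f : X → ℝ} (hf : Measurable f)
    {V : ℝ} (hV : ∀ x, f x ∈ Set.Icc 0 V) : ∫ x, f x ∂ν ∈ Set.Icc 0 V := by
  refine ⟨integral_nonneg fun x => (hV x).1, ?_⟩
  calc ∫ x, f x ∂ν ≤ ∫ _, V ∂ν :=
        integral_mono (integrable_of_mem_Icc hf hV) (integrable_const _) fun x => (hV x).2
    _ = V := by simp

lemma measurable_integral_kernel (κ : Kernel X Y) {f : Y → ℝ} (hf : Measurable f) :
    Measurable fun x => ∫ y, f y ∂(κ x) :=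
  (hf.stronglyMeasurable.integral_kernel (κ := κ)).measurable

lemma integral_bind_of_abs_le {ν : Measure X} [IsFiniteMeasure ν] (κ : Kernel X Y)
    [IsMarkovKernel κ] {f : Y → ℝ} (hf : Measurable f) {K : ℝ} (hK : ∀ y, |f y| ≤ K) :
    ∫ y, f y ∂(ν.bind κ) = ∫ x, ∫ y, f y ∂(κ x) ∂ν := by
  rw [Measure.comp_eq_comp_const_apply, Kernel.integral_comp (integrable_of_abs_le hf hK)]
  rfl

lemma integral_id_prod (κ : Kernel X Y) [IsMarkovKernel κ] {f : X × Y → ℝ} (hf : Measurable f)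
    (x : X) : ∫ z, f z ∂((Kernel.id ×ₖ κ) x) = ∫ y, f (x, y) ∂(κ x) := by
  rw [Kernel.prod_apply, Kernel.id_apply, Measure.dirac_prod,
    integral_map measurable_prodMk_left.aemeasurable hf.aestronglyMeasurable]

lemma measurable_integral_section (κ : Kernel X Y) [IsMarkovKernel κ] {f : X × Y → ℝ}
    (hf : Measurable f) : Measurable fun x => ∫ y, f (x, y) ∂(κ x) :=
  (hf.stronglyMeasurable.integral_kernel_prod_right' (κ := κ)).measurable

lemma integral_abs_le_l2norm (μ : Measure X) [IsProbabilityMeasure μ] {f : X → ℝ}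
    (hf : Measurable f) {K : ℝ} (hK : ∀ x, |f x| ≤ K) : ∫ x, |f x| ∂μ ≤ l2norm μ f := by
  have hm : MemLp (fun x => |f x|) 2 μ :=
    MemLp.of_bound hf.abs.aestronglyMeasurable K
      (Filter.Eventually.of_forall fun x => by simpa using hK x)
  -- Cauchy–Schwarz against the constant one, read as nonnegativity of the variance of `|f|`.
  have h := variance_nonneg (fun x => |f x|) μ
  rw [variance_eq_sub hm] at h
  simp only [Pi.pow_apply, sq_abs] at h
  exact Real.le_sqrt_of_sq_le (by linarith)

/-- Expectations of `[0, V]`-valued functions differ by at most `V` times the total variation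
distance. -/
lemma integral_le_add_tvDist {ν μ : Measure X} [IsProbabilityMeasure ν] [IsProbabilityMeasure μ]
    {ε V : ℝ} (hε : tvDist ν μ ≤ ε) {h : X → ℝ} (hm : Measurable h)
    (hV : ∀ x, h x ∈ Set.Icc 0 V) : ∫ x, h x ∂ν ≤ ∫ x, h x ∂μ + V * ε := by
  have hB : ∀ B : Set X, MeasurableSet B → ν.real B ≤ μ.real B + ε := by
    intro B hB
    have hbdd : BddAbove (Set.range fun B : {B : Set X // MeasurableSet B} =>
        |ν.real B - μ.real B|) := by
      refine ⟨1, ?_⟩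
      rintro _ ⟨B, rfl⟩
      have h1 : ν.real (B : Set X) ≤ 1 := measureReal_le_one
      have h2 : μ.real (B : Set X) ≤ 1 := measureReal_le_one
      have h3 : 0 ≤ ν.real (B : Set X) := measureReal_nonneg
      have h4 : 0 ≤ μ.real (B : Set X) := measureReal_nonneg
      exact abs_le.2 ⟨by linarith, by linarith⟩
    have := (le_ciSup hbdd ⟨B, hB⟩).trans hε
    have := (abs_le.1 this).2
    linarith
  have hε0 : 0 ≤ ε := by
    have := hB Set.univ MeasurableSet.univ
    simpa using this
  by_cases hX : Nonempty X
  swap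
  · have : IsEmpty X := not_nonempty_iff.1 hX
    exact absurd (measure_univ (μ := ν)) (by simp [Set.univ_eq_empty_iff.2 this])
  obtain ⟨x₀⟩ := hX
  have hV0 : 0 ≤ V := (hV x₀).1.trans (hV x₀).2
  -- Layer cake: level sets above `V` are empty, so comparing the two measures level by level over
  -- an interval of length `V` gives exactly `V * ε`, with no factor two.
  have key : ∀ ξ : Measure X, IsProbabilityMeasure ξ →
      ∫⁻ x, ENNReal.ofReal (h x) ∂ξ = ∫⁻ t in Set.Ioc 0 V, ξ {a | t < h a} := by
    intro ξ _
    rw [lintegral_eq_lintegral_meas_lt ξ (Filter.Eventually.of_forall fun x => (hV x).1)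
      hm.aemeasurable]
    rw [← lintegral_indicator measurableSet_Ioi, ← lintegral_indicator measurableSet_Ioc]
    refine lintegral_congr fun t => ?_
    by_cases ht : t ∈ Set.Ioc 0 V
    · rw [Set.indicator_of_mem ht, Set.indicator_of_mem (Set.Ioc_subset_Ioi_self ht)]
    · rw [Set.indicator_of_notMem ht]
      by_cases ht0 : 0 < t
      · have hempty : {a | t < h a} = ∅ := by
          ext a
          simp only [Set.mem_ofPred_eq, Set.mem_empty_iff_false, iff_false, not_lt]
          by_contra hlt
          exact ht ⟨ht0, ((not_le.1 hlt).trans_le (hV a).2).le⟩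
        rw [Set.indicator_of_mem (show t ∈ Set.Ioi 0 from ht0), hempty, measure_empty]
      · exact Set.indicator_of_notMem ht0 _
  have hle : ∫⁻ x, ENNReal.ofReal (h x) ∂ν ≤
      ∫⁻ x, ENNReal.ofReal (h x) ∂μ + ENNReal.ofReal (V * ε) := by
    rw [key ν inferInstance, key μ inferInstance]
    calc ∫⁻ t in Set.Ioc 0 V, ν {a | t < h a}
        ≤ ∫⁻ t in Set.Ioc 0 V, (μ {a | t < h a} + ENNReal.ofReal ε) := by
          refine lintegral_mono fun t => ?_
          have h1 := hB _ (measurableSet_lt measurable_const hm : MeasurableSet {a | t < h a})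
          rw [← ofReal_measureReal (μ := ν), ← ofReal_measureReal (μ := μ),
            ← ENNReal.ofReal_add measureReal_nonneg hε0]
          exact ENNReal.ofReal_le_ofReal h1
      _ = _ := by
          rw [lintegral_add_right _ measurable_const]
          simp [ENNReal.ofReal_mul hε0, mul_comm]
  have hi := fun (ξ : Measure X) (_ : IsProbabilityMeasure ξ) =>
    ofReal_integral_eq_lintegral_ofReal (integrable_of_mem_Icc (ν := ξ) hm hV)
      (Filter.Eventually.of_forall fun x => (hV x).1)
  rw [← hi ν inferInstance, ← hi μ inferInstance, ← ENNReal.ofReal_add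
    (integral_nonneg fun x => (hV x).1) (mul_nonneg hV0 hε0)] at hle
  exact (ENNReal.ofReal_le_ofReal_iff (add_nonneg (integral_nonneg fun x => (hV x).1)
    (mul_nonneg hV0 hε0))).1 hle

/-- A measurable selection of near-maximizers over a countable set. -/
lemma exists_measurable_near_argmax [Countable Y] [Nonempty Y] [DiscreteMeasurableSpace Y]
    {m : X × Y → ℝ} (hm : Measurable m)
    (ε : ℝ) (hε : 0 < ε) :
    ∃ a : X → Y, Measurable a ∧ ∀ x, ⨆ y, m (x, y) ≤ m (x, a x) + ε := by
  classical
  obtain ⟨e, he⟩ := exists_surjective_nat Y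
  have hex : ∀ x, ∃ k, ⨆ y, m (x, y) ≤ m (x, e k) + ε := by
    intro x
    obtain ⟨y, hy⟩ := exists_lt_of_lt_ciSup (f := fun y => m (x, y))
      (show (⨆ y, m (x, y)) - ε < ⨆ y, m (x, y) by linarith)
    obtain ⟨k, rfl⟩ := he y
    exact ⟨k, by linarith⟩
  have hsec : ∀ y, Measurable fun x => m (x, y) := fun y => hm.comp measurable_prodMk_right
  -- Taking the least index in an enumeration makes the selection measurable. The slack `ε` is
  -- needed because a supremum over infinitely many actions may not be attained.
  refine ⟨fun x => e (Nat.find (hex x)), ?_, fun x => Nat.find_spec (hex x)⟩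
  refine (measurable_from_nat (f := e)).comp (measurable_find hex fun k => ?_)
  exact measurableSet_le (Measurable.iSup hsec) ((hsec _).add_const _)

/-- Chernoff bound for the lower tail of a sum of independent copies of a bounded variable. -/
lemma measure_sum_nonpos_le {Z : Type*} [MeasurableSpace Z] (P : Measure Z)
    [IsProbabilityMeasure P] (n : ℕ) {Y : Z → ℝ} (hY : Measurable Y) {l : ℝ} (hl : 0 ≤ l)
    (hb : ∀ᵐ z ∂P, |l * Y z| ≤ 1) (hi : Integrable Y P) (hi2 : Integrable (fun z => Y z ^ 2) P) :
    (Measure.pi fun _ : Fin n => P).real {D | ∑ i, Y (D i) ≤ 0} ≤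
      Real.exp (-(n * (l * ∫ z, Y z ∂P - l ^ 2 * ∫ z, Y z ^ 2 ∂P))) := by
  have hexpi : Integrable (fun z => Real.exp (-(l * Y z))) P := by
    refine Integrable.of_bound (by fun_prop) (Real.exp 1) ?_
    filter_upwards [hb] with z hz
    rw [Real.norm_eq_abs, Real.abs_exp]
    exact Real.exp_le_exp.2 (by linarith [(abs_le.1 hz).1])
  -- Uses `exp (-x) ≤ 1 - x + x ^ 2` for `|x| ≤ 1`. Retaining the second moment, rather than a sup
  -- bound, is what later yields the fast rate.
  have hmgf : ∫ z, Real.exp (-(l * Y z)) ∂P ≤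
      Real.exp (-(l * ∫ z, Y z ∂P - l ^ 2 * ∫ z, Y z ^ 2 ∂P)) := by
    calc ∫ z, Real.exp (-(l * Y z)) ∂P ≤ ∫ z, (1 - l * Y z + l ^ 2 * Y z ^ 2) ∂P := by
          refine integral_mono_ae hexpi
            (((integrable_const _).sub (hi.const_mul _)).add (hi2.const_mul _)) ?_
          filter_upwards [hb] with z hz
          have := Real.abs_exp_sub_one_sub_id_le (x := -(l * Y z)) (by rwa [abs_neg])
          have := (abs_le.1 this).2
          nlinarith
      _ = 1 - l * ∫ z, Y z ∂P + l ^ 2 * ∫ z, Y z ^ 2 ∂P := by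
          have h1 : Integrable (fun z => 1 - l * Y z) P :=
            (integrable_const _).sub (hi.const_mul _)
          rw [integral_add h1 (hi2.const_mul _),
            integral_sub (integrable_const _) (hi.const_mul _), integral_const_mul,
            integral_const_mul]
          simp
      _ ≤ _ := by
          have := Real.add_one_le_exp (-(l * ∫ z, Y z ∂P - l ^ 2 * ∫ z, Y z ^ 2 ∂P))
          linarith
  have hprod : ∀ D : Fin n → Z, ∏ i, Real.exp (-(l * Y (D i))) =
      Real.exp (-(l * ∑ i, Y (D i))) := by
    intro D
    rw [← Real.exp_sum, Finset.mul_sum, Finset.sum_neg_distrib]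
  have hint : Integrable (fun D : Fin n → Z => ∏ i, Real.exp (-(l * Y (D i))))
      (Measure.pi fun _ : Fin n => P) :=
    Integrable.fintype_prod (f := fun _ z => Real.exp (-(l * Y z))) fun _ => hexpi
  have hmark := mul_meas_ge_le_integral_of_nonneg
    (Filter.Eventually.of_forall fun D =>
      Finset.prod_nonneg fun i _ => (Real.exp_pos (-(l * Y (D i)))).le) hint 1
  rw [one_mul] at hmark
  calc (Measure.pi fun _ : Fin n => P).real {D | ∑ i, Y (D i) ≤ 0}
      ≤ (Measure.pi fun _ : Fin n => P).real
          {D | 1 ≤ ∏ i, Real.exp (-(l * Y (D i)))} := by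
        refine measureReal_mono fun D hD => ?_
        rw [Set.mem_ofPred_eq, hprod]
        exact Real.one_le_exp (by
          have : l * ∑ i, Y (D i) ≤ 0 := mul_nonpos_of_nonneg_of_nonpos hl hD
          linarith)
    _ ≤ ∫ D : Fin n → Z, ∏ i, Real.exp (-(l * Y (D i))) ∂(Measure.pi fun _ : Fin n => P) := hmark
    _ = (∫ z, Real.exp (-(l * Y z)) ∂P) ^ n := by
        rw [integral_fintype_prod_eq_pow (fun z => Real.exp (-(l * Y z))), Fintype.card_fin]
    _ ≤ Real.exp (-(l * ∫ z, Y z ∂P - l ^ 2 * ∫ z, Y z ^ 2 ∂P)) ^ n :=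
        pow_le_pow_left₀ (integral_nonneg fun z => (Real.exp_pos _).le) hmgf n
    _ = _ := by rw [← Real.exp_nat_mul]; congr 1; ring

end Generic

end MBS

namespace MBS

/-! ### Exchanging discounted sums and integrals. -/

section DiscountedSum

variable {X Y Z : Type*} [MeasurableSpace X] [MeasurableSpace Y] [MeasurableSpace Z]

lemma summable_discounted {g : ℝ} (hg : 0 ≤ g) (hg1 : g < 1) {u : ℕ → ℝ} {K : ℝ}
    (hu : ∀ h, |u h| ≤ K) : Summable fun h => g ^ h * u h := by
  refine Summable.of_norm_bounded ((summable_geometric_of_lt_one hg hg1).mul_right K) fun h => ?_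
  rw [Real.norm_eq_abs, abs_mul, abs_of_nonneg (pow_nonneg hg h)]
  exact mul_le_mul_of_nonneg_left (hu h) (pow_nonneg hg h)

/-- Geometric weights make the series absolutely summable in `L¹`. This one exchange gives both
`V_eq_integral_Q` and `Q_eq`. -/
lemma integral_discounted_sum {g : ℝ} (hg : 0 ≤ g) (hg1 : g < 1) (κ : ℕ → Kernel X Y)
    [∀ h, IsMarkovKernel (κ h)] (ξ : Kernel Z X) [IsMarkovKernel ξ] {r : Y → ℝ}
    (hr : Measurable r) {K : ℝ} (hK : ∀ y, r y ∈ Set.Icc 0 K) (z : Z) :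
    ∫ x, (∑' h, g ^ h * ∫ y, r y ∂(κ h x)) ∂(ξ z) =
      ∑' h, g ^ h * ∫ y, r y ∂((κ h ∘ₖ ξ) z) := by
  have hin : ∀ h x, ∫ y, r y ∂(κ h x) ∈ Set.Icc 0 K := fun h x => integral_mem_Icc hr hK
  have hmeas : ∀ h, Measurable fun x => ∫ y, r y ∂(κ h x) := fun h =>
    measurable_integral_kernel (κ h) hr
  have hint : ∀ h, Integrable (fun x => g ^ h * ∫ y, r y ∂(κ h x)) (ξ z) := fun h =>
    (integrable_of_mem_Icc (hmeas h) (hin h)).const_mul _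
  rw [← integral_tsum_of_summable_integral_norm hint]
  · refine tsum_congr fun h => ?_
    rw [integral_const_mul, Kernel.integral_comp (integrable_of_mem_Icc hr hK)]
  · have : ∀ h, ∫ x, ‖g ^ h * ∫ y, r y ∂(κ h x)‖ ∂(ξ z) =
        g ^ h * ∫ x, ∫ y, r y ∂(κ h x) ∂(ξ z) := by
      intro h
      rw [← integral_const_mul]
      refine integral_congr_ae (Filter.Eventually.of_forall fun x => ?_)
      exact Real.norm_of_nonneg (mul_nonneg (pow_nonneg hg h) (hin h x).1)
    simp_rw [this]
    exact summable_discounted hg hg1 (K := K) fun h =>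
      abs_le_of_mem_Icc (integral_mem_Icc (hmeas h) (hin h))

end DiscountedSum

/-! ### Value functions, the policy evaluation equation and reachable state laws. -/

namespace MDP

variable {S A : Type*} [MeasurableSpace S] [MeasurableSpace A] (M : MDP S A)

instance isMarkovKernel_lawFromState (π : ℕ → Policy S A) (h : ℕ) :
    IsMarkovKernel (M.lawFromState π h) := by
  induction h with
  | zero => unfold lawFromState; infer_instance
  | succ h ih => unfold lawFromState; infer_instance

instance isMarkovKernel_lawFromPair (π : Policy S A) (h : ℕ) :
    IsMarkovKernel (M.lawFromPair π h) := by
  cases h <;> unfold lawFromPair <;> infer_instance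

instance isProbabilityMeasure_η (π : ℕ → Policy S A) (h : ℕ) :
    IsProbabilityMeasure (M.η π h) := by
  unfold η; infer_instance

lemma lawFromState_eq_lawFromPair_comp (π : Policy S A) (h : ℕ) :
    M.lawFromState (fun _ => π) h = M.lawFromPair π h ∘ₖ (Kernel.id ×ₖ π.kernel) := by
  cases h with
  | zero => simp [lawFromState, lawFromPair, Kernel.id_comp]
  | succ h =>
    induction h with
    | zero => simp [lawFromState, lawFromPair, Kernel.comp_assoc]
    | succ h ih =>
      rw [lawFromState, ih, lawFromPair, lawFromPair, lawFromState]
      simp only [Kernel.comp_assoc]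

lemma measurable_meanReward : Measurable M.meanReward :=
  measurable_integral_kernel M.R measurable_id

variable {M} {Vmax : ℝ}

lemma meanReward_mem (hV : M.ValuesBoundedBy Vmax) (x : S × A) :
    M.meanReward x ∈ Set.Icc 0 Vmax := by
  have h := hV.1 x
  have hb : ∀ᵐ r ∂(M.R x), ‖r‖ ≤ Vmax := by
    filter_upwards [h] with r hr using abs_le_of_mem_Icc hr
  refine ⟨integral_nonneg_of_ae (by filter_upwards [h] with r hr using hr.1), ?_⟩
  calc M.meanReward x ≤ ∫ _, Vmax ∂(M.R x) :=
        integral_mono_ae (Integrable.of_bound (by fun_prop) Vmax hb) (integrable_const _)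
          (by filter_upwards [h] with r hr using hr.2)
    _ = Vmax := by simp

lemma V_eq_integral_Q (hV : M.ValuesBoundedBy Vmax) (π : Policy S A) (s : S)
    (hQ : Measurable (M.Q π)) :
    M.V π s = ∫ a, M.Q π (s, a) ∂(π.kernel s) := by
  rw [← integral_id_prod π.kernel hQ]
  simp only [V, Q]
  rw [integral_discounted_sum M.γ_nonneg M.γ_lt_one _ _ M.measurable_meanReward
    (meanReward_mem hV)]
  simp_rw [lawFromState_eq_lawFromPair_comp]

lemma measurable_Q (hV : M.ValuesBoundedBy Vmax) (π : Policy S A) : Measurable (M.Q π) := by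
  refine measurable_of_tendsto_metrizable (f := fun N x => ∑ h ∈ Finset.range N,
    M.γ ^ h * ∫ y, M.meanReward y ∂(M.lawFromPair π h x)) (fun N => ?_) ?_
  · exact Finset.measurable_fun_sum _ fun h _ =>
      (measurable_integral_kernel _ M.measurable_meanReward).const_mul _
  · rw [tendsto_pi_nhds]
    intro x
    exact (summable_discounted M.γ_nonneg M.γ_lt_one (K := Vmax) fun h => abs_le_of_mem_Icc
      (integral_mem_Icc M.measurable_meanReward (meanReward_mem hV))).hasSum.tendsto_sum_nat

lemma V_mem (hV : M.ValuesBoundedBy Vmax) (π : Policy S A) (s : S) :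
    M.V π s ∈ Set.Icc 0 Vmax := by
  rw [V_eq_integral_Q hV π s (measurable_Q hV π)]
  exact integral_mem_Icc ((measurable_Q hV π).comp measurable_prodMk_left) fun a => hV.2 π _

lemma measurable_V (hV : M.ValuesBoundedBy Vmax) (π : Policy S A) : Measurable (M.V π) := by
  rw [funext fun s => V_eq_integral_Q hV π s (measurable_Q hV π)]
  exact measurable_integral_section π.kernel (measurable_Q hV π)

lemma Q_eq (hV : M.ValuesBoundedBy Vmax) (π : Policy S A) (x : S × A) :
    M.Q π x = M.meanReward x + M.γ * ∫ s', M.V π s' ∂(M.P x) := by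
  have hsum : Summable fun h => M.γ ^ h * ∫ y, M.meanReward y ∂(M.lawFromPair π h x) :=
    summable_discounted M.γ_nonneg M.γ_lt_one (K := Vmax) fun h => abs_le_of_mem_Icc
      (integral_mem_Icc M.measurable_meanReward (meanReward_mem hV))
  rw [Q, hsum.tsum_eq_zero_add]
  simp only [V]
  rw [integral_discounted_sum M.γ_nonneg M.γ_lt_one _ _ M.measurable_meanReward
    (meanReward_mem hV), ← tsum_mul_left]
  congr 1
  · simp only [lawFromPair, pow_zero, one_mul, Kernel.id_apply]
    exact integral_dirac' _ _ M.measurable_meanReward.stronglyMeasurable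
  · exact tsum_congr fun h => by rw [lawFromPair]; ring

lemma V_ofFun (hV : M.ValuesBoundedBy Vmax) {g : S → A} (hg : Measurable g) (s : S) :
    M.V (Policy.ofFun g hg) s = M.Q (Policy.ofFun g hg) (s, g s) := by
  rw [V_eq_integral_Q hV _ _ (measurable_Q hV _)]
  exact Kernel.integral_deterministic' hg
    ((measurable_Q hV _).comp measurable_prodMk_left).stronglyMeasurable

variable (M) in
/-- The laws of `s_h` under non-stationary policies, with `s_0 ∼ ρ`. -/
inductive IsStateLaw : Measure S → Prop
  | init : IsStateLaw M.ρ
  | step (σ : Measure S) (π : Policy S A) : IsStateLaw σ →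
      IsStateLaw ((σ.bind (Kernel.id ×ₖ π.kernel)).bind M.P)

lemma IsStateLaw.isProbabilityMeasure {σ : Measure S} (hσ : M.IsStateLaw σ) :
    IsProbabilityMeasure σ := by
  induction hσ with
  | init => infer_instance
  | step σ π _ ih => infer_instance

lemma lawFromState_congr {π π' : ℕ → Policy S A} (h : ℕ) (hπ : ∀ i ≤ h, π i = π' i) :
    M.lawFromState π h = M.lawFromState π' h := by
  induction h with
  | zero => simp only [lawFromState, hπ 0 le_rfl]
  | succ h ih => simp only [lawFromState, hπ (h + 1) le_rfl, ih fun i hi => hπ i (by omega)]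

/-- A reachable law of `s_h` involves only the policies before time `h`, so the policy at time `h`
can be overwritten freely. Non-stationary policies are needed because the error recursion selects a
different near-greedy policy at each step. -/
lemma IsStateLaw.exists_η_eq {σ : Measure S} (hσ : M.IsStateLaw σ) (π : Policy S A) :
    ∃ (πs : ℕ → Policy S A) (h : ℕ), M.η πs h = σ.bind (Kernel.id ×ₖ π.kernel) := by
  suffices H : ∃ (πs : ℕ → Policy S A) (h : ℕ),
      M.η (Function.update πs h π) h = σ.bind (Kernel.id ×ₖ π.kernel) by
    obtain ⟨πs, h, H⟩ := H
    exact ⟨_, h, H⟩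
  induction hσ generalizing π with
  | init => exact ⟨fun _ => π, 0, by simp [η, lawFromState]⟩
  | step σ π₀ _ ih =>
    obtain ⟨πs, h, H⟩ := ih π₀
    refine ⟨Function.update πs h π₀, h + 1, ?_⟩
    rw [← H, η, η, lawFromState, ← Measure.comp_assoc, ← Measure.comp_assoc,
      lawFromState_congr (π' := Function.update πs h π₀) h fun i hi =>
        Function.update_of_ne (by omega) _ _]
    simp

end MDP

end MBS

/-! ### The filtered maximum. -/

namespace MBS

/-- The filtered greedy value `max_a ζ(s, a) f(s, a)`. -/
noncomputable def maxValue {S A : Type*} (ζ f : S × A → ℝ) (s : S) : ℝ :=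
  ⨆ a : A, ζ (s, a) * f (s, a)

section MaxValue

variable {S A : Type*} {ζ f g : S × A → ℝ} {V : ℝ}

lemma mul_mem_Icc_of_filter (hζ : ∀ x, ζ x ∈ Set.Icc 0 1) (hf : ∀ x, f x ∈ Set.Icc 0 V)
    (x : S × A) : ζ x * f x ∈ Set.Icc 0 V :=
  ⟨mul_nonneg (hζ x).1 (hf x).1,
    (mul_le_of_le_one_left (hf x).1 (hζ x).2).trans (hf x).2⟩

lemma bddAbove_range_filtered (hζ : ∀ x, ζ x ∈ Set.Icc 0 1) (hf : ∀ x, f x ∈ Set.Icc 0 V)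
    (s : S) : BddAbove (Set.range fun a : A => ζ (s, a) * f (s, a)) := by
  refine ⟨V, ?_⟩
  rintro _ ⟨a, rfl⟩
  exact (mul_mem_Icc_of_filter hζ hf (s, a)).2

lemma le_maxValue (hζ : ∀ x, ζ x ∈ Set.Icc 0 1) (hf : ∀ x, f x ∈ Set.Icc 0 V) (s : S) (a : A) :
    ζ (s, a) * f (s, a) ≤ maxValue ζ f s :=
  le_ciSup (bddAbove_range_filtered hζ hf s) a

lemma abs_sub_mem_Icc (hf : ∀ x, f x ∈ Set.Icc 0 V) (hg : ∀ x, g x ∈ Set.Icc 0 V) (x : S × A) :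
    |f x - g x| ∈ Set.Icc 0 V :=
  ⟨abs_nonneg _, abs_le.2 ⟨by linarith [(hf x).1, (hg x).2], by linarith [(hf x).2, (hg x).1]⟩⟩

lemma measurable_maxValue [MeasurableSpace S] [MeasurableSpace A] [Countable A]
    (hζ : Measurable ζ) (hf : Measurable f) : Measurable (maxValue ζ f) :=
  Measurable.iSup fun _ => (hζ.mul hf).comp measurable_prodMk_right

variable [Nonempty A]

lemma maxValue_mem (hζ : ∀ x, ζ x ∈ Set.Icc 0 1) (hf : ∀ x, f x ∈ Set.Icc 0 V) (s : S) :
    maxValue ζ f s ∈ Set.Icc 0 V :=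
  ⟨(mul_mem_Icc_of_filter hζ hf (s, Classical.arbitrary A)).1.trans (le_maxValue hζ hf s _),
    ciSup_le fun a => (mul_mem_Icc_of_filter hζ hf (s, a)).2⟩

lemma maxValue_le_add (hζ : ∀ x, ζ x ∈ Set.Icc 0 1) (hf : ∀ x, f x ∈ Set.Icc 0 V)
    (hg : ∀ x, g x ∈ Set.Icc 0 V) (s : S) :
    maxValue ζ f s ≤ maxValue ζ g s + maxValue ζ (fun x => |f x - g x|) s := by
  refine ciSup_le fun a => ?_
  have h1 := le_maxValue hζ hg s a
  have h2 := le_maxValue hζ (abs_sub_mem_Icc hf hg) s a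
  have h3 := mul_le_mul_of_nonneg_left (le_abs_self (f (s, a) - g (s, a))) (hζ (s, a)).1
  linarith

lemma abs_maxValue_sub_le (hζ : ∀ x, ζ x ∈ Set.Icc 0 1) (hf : ∀ x, f x ∈ Set.Icc 0 V)
    (hg : ∀ x, g x ∈ Set.Icc 0 V) (s : S) :
    |maxValue ζ f s - maxValue ζ g s| ≤ maxValue ζ (fun x => |f x - g x|) s := by
  have h1 := maxValue_le_add hζ hf hg s
  have h2 := maxValue_le_add hζ hg hf s
  simp only [abs_sub_comm (g _)] at h2
  exact abs_le.2 ⟨by linarith, by linarith⟩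

end MaxValue

/-! ### The filtered Bellman operator and the concentration property. -/

namespace MDP

variable {S A : Type*} [MeasurableSpace S] [MeasurableSpace A] {M : MDP S A}
  {ζ : S × A → ℝ} {Vmax : ℝ}

lemma bellman_eq (f : S × A → ℝ) (x : S × A) :
    M.bellman ζ f x = M.meanReward x + M.γ * ∫ s', maxValue ζ f s' ∂(M.P x) := rfl

lemma integral_bind_ofFun {σ : Measure S} [IsFiniteMeasure σ] {a : S → A} (ha : Measurable a)
    {F : S × A → ℝ} (hF : Measurable F) {K : ℝ} (hK : ∀ x, |F x| ≤ K) :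
    ∫ x, F x ∂(σ.bind (Kernel.id ×ₖ (Policy.ofFun a ha).kernel)) = ∫ s, F (s, a s) ∂σ := by
  rw [integral_bind_of_abs_le _ hF hK]
  refine integral_congr_ae (Filter.Eventually.of_forall fun s => ?_)
  simp only
  rw [integral_id_prod _ hF]
  exact Kernel.integral_deterministic' ha (hF.comp measurable_prodMk_left).stronglyMeasurable

lemma measurable_bellman [Countable A] (hζm : Measurable ζ) {f : S × A → ℝ} (hf : Measurable f) :
    Measurable (M.bellman ζ f) :=
  M.measurable_meanReward.add
    ((measurable_integral_kernel M.P (measurable_maxValue hζm hf)).const_mul _)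

variable [Countable A] [Nonempty A]

lemma bellman_mem (hV : M.ValuesBoundedBy Vmax) (hζm : Measurable ζ)
    (hζ : ∀ x, ζ x ∈ Set.Icc 0 1) {f : S × A → ℝ} (hf : Measurable f)
    (hfV : ∀ x, f x ∈ Set.Icc 0 Vmax) (x : S × A) :
    M.bellman ζ f x ∈ Set.Icc 0 (2 * Vmax) := by
  have h1 := meanReward_mem hV x
  have h2 := integral_mem_Icc (ν := M.P x) (measurable_maxValue hζm hf) (maxValue_mem hζ hfV)
  rw [bellman_eq]
  have h3 := mul_le_of_le_one_left h2.1 M.γ_lt_one.le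
  exact ⟨add_nonneg h1.1 (mul_nonneg M.γ_nonneg h2.1), by linarith [h1.2, h2.2]⟩

lemma abs_sub_bellman_le (hV : M.ValuesBoundedBy Vmax) (hζm : Measurable ζ)
    (hζ : ∀ x, ζ x ∈ Set.Icc 0 1) {f g : S × A → ℝ} (hf : Measurable f)
    (hfV : ∀ x, f x ∈ Set.Icc 0 Vmax) (hgV : ∀ x, g x ∈ Set.Icc 0 Vmax) (x : S × A) :
    |g x - M.bellman ζ f x| ≤ 2 * Vmax := by
  have h1 := bellman_mem hV hζm hζ hf hfV x
  have h2 := hgV x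
  exact abs_le.2 ⟨by linarith [h1.2, h2.1], by linarith [h1.1, h2.1, h2.2]⟩

/-- The contraction is kept as an expectation over the next state instead of a sup norm: integrated
against a reachable law, the right side becomes an integral under the next reachable state law. -/
lemma abs_bellman_sub_bellman_le (hζm : Measurable ζ)
    (hζ : ∀ x, ζ x ∈ Set.Icc 0 1) {f g : S × A → ℝ} (hf : Measurable f) (hg : Measurable g)
    (hfV : ∀ x, f x ∈ Set.Icc 0 Vmax) (hgV : ∀ x, g x ∈ Set.Icc 0 Vmax) (x : S × A) :
    |M.bellman ζ f x - M.bellman ζ g x| ≤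
      M.γ * ∫ s', maxValue ζ (fun y => |f y - g y|) s' ∂(M.P x) := by
  have hif := integrable_of_mem_Icc (ν := M.P x) (measurable_maxValue hζm hf)
    (maxValue_mem hζ hfV)
  have hig := integrable_of_mem_Icc (ν := M.P x) (measurable_maxValue hζm hg)
    (maxValue_mem hζ hgV)
  have hid := integrable_of_mem_Icc (ν := M.P x) (measurable_maxValue hζm (hf.sub hg).abs)
    (maxValue_mem hζ (abs_sub_mem_Icc hfV hgV))
  rw [bellman_eq, bellman_eq, add_sub_add_left_eq_sub, ← mul_sub, ← integral_sub hif hig, abs_mul,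
    abs_of_nonneg M.γ_nonneg]
  refine mul_le_mul_of_nonneg_left ?_ M.γ_nonneg
  exact abs_integral_le_integral_abs.trans
    (integral_mono (hif.sub hig).abs hid fun s => abs_maxValue_sub_le hζ hfV hgV s)

variable (M) in
/-- Filtered expectations of `[0, V]`-valued functions under every state-action law reachable by
a policy are dominated by expectations under `μ`, up to a factor `C` and an additive error `κ`. -/
def ConcentrateOn (μ : Measure (S × A)) (ζ : S × A → ℝ) (C V κ : ℝ) : Prop :=
  ∀ σ, M.IsStateLaw σ → ∀ (π : Policy S A) (h : S × A → ℝ), Measurable h →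
    (∀ x, h x ∈ Set.Icc 0 V) →
      ∫ x, ζ x * h x ∂(σ.bind (Kernel.id ×ₖ π.kernel)) ≤ C * (∫ x, h x ∂μ + κ)

variable {μ : Measure (S × A)} [IsProbabilityMeasure μ] {C κ : ℝ}

/-! ### Error propagation through the iterates and along the greedy policy. -/

section Iterates

variable [DiscreteMeasurableSpace A]

/-- Induction on `k`, uniformly over state laws. A near-maximizing action turns the maximum into an
expectation under a state-action law, the triangle inequality through the Bellman images of `f k`
and `g` splits off the two errors, and the remaining term is the induction hypothesis at the
successor state law. -/
lemma integral_maxValue_abs_sub_le (hV : M.ValuesBoundedBy Vmax) (hζm : Measurable ζ)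
    (hζ : ∀ x, ζ x ∈ Set.Icc 0 1) (hC : 0 ≤ C) (hμ : M.ConcentrateOn μ ζ C Vmax κ) (hκ : 0 ≤ κ)
    {g : S × A → ℝ} (hg : Measurable g) (hgV : ∀ x, g x ∈ Set.Icc 0 Vmax)
    {f : ℕ → S × A → ℝ} {t : ℕ} (hf : ∀ k ≤ t, Measurable (f k))
    (hfV : ∀ k ≤ t, ∀ x, f k x ∈ Set.Icc 0 Vmax) {ε ε' : ℝ}
    (hε : ∀ k < t, ∫ x, |f (k + 1) x - M.bellman ζ (f k) x| ∂μ ≤ ε)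
    (hε' : ∫ x, |g x - M.bellman ζ g x| ∂μ ≤ ε') (hε0 : 0 ≤ ε) :
    ∀ k ≤ t, ∀ σ, M.IsStateLaw σ → ∫ s, maxValue ζ (fun x => |f k x - g x|) s ∂σ ≤
      C * (ε + ε' + κ) / (1 - M.γ) + M.γ ^ k * Vmax := by
  have hγ : 0 < 1 - M.γ := by linarith [M.γ_lt_one]
  have hε'0 : 0 ≤ ε' := (integral_nonneg fun x => abs_nonneg _).trans hε'
  intro k
  induction k with
  | zero =>
    intro _ σ hσ
    have := hσ.isProbabilityMeasure
    have h1 := (integral_mem_Icc (ν := σ) (measurable_maxValue hζm ((hf 0 (by omega)).sub hg).abs)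
      (maxValue_mem hζ (abs_sub_mem_Icc (hfV 0 (by omega)) hgV))).2
    have : 0 ≤ C * (ε + ε' + κ) / (1 - M.γ) := by positivity
    simpa using h1.trans (by linarith)
  | succ k ih =>
    intro hk σ hσ
    have := hσ.isProbabilityMeasure
    have hfk := hf k (by omega)
    have hfkV := hfV k (by omega)
    have hd := abs_sub_mem_Icc (hfV (k + 1) hk) hgV
    have hdm : Measurable fun x => |f (k + 1) x - g x| := ((hf (k + 1) hk).sub hg).abs
    have hq := maxValue_mem hζ (abs_sub_mem_Icc hfkV hgV)
    have hqm : Measurable (maxValue ζ fun x => |f k x - g x|) :=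
      measurable_maxValue hζm (hfk.sub hg).abs
    set q : S × A → ℝ := fun x => ∫ s', maxValue ζ (fun y => |f k y - g y|) s' ∂(M.P x) with hqdef
    have hqV : ∀ x, q x ∈ Set.Icc 0 Vmax := fun x => integral_mem_Icc hqm hq
    have hqmeas : Measurable q := measurable_integral_kernel M.P hqm
    set e : S × A → ℝ := fun x => |f (k + 1) x - M.bellman ζ (f k) x| + |g x - M.bellman ζ g x|
      with hedef
    have hem : Measurable e := ((hf (k + 1) hk).sub (measurable_bellman hζm hfk)).abs.add
      (hg.sub (measurable_bellman hζm hg)).abs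
    have he0 : ∀ x, 0 ≤ e x := fun x => add_nonneg (abs_nonneg _) (abs_nonneg _)
    have hV0 : ∀ x : S × A, 0 ≤ Vmax := fun x => (hgV x).1.trans (hgV x).2
    -- Truncating at `Vmax` costs nothing, since `|f (k + 1) - g| ≤ Vmax` already, and it brings the
    -- error into the range for which concentration holds with error `κ`.
    have hw : ∀ x, min Vmax (e x) ∈ Set.Icc 0 Vmax := fun x =>
      ⟨le_min (hV0 x) (he0 x), min_le_left _ _⟩
    have hwm : Measurable fun x => min Vmax (e x) := measurable_const.min hem
    have hpt : ∀ x, ζ x * |f (k + 1) x - g x| ≤ ζ x * min Vmax (e x) + M.γ * q x := by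
      intro x
      have h1 : |f (k + 1) x - g x| ≤ min Vmax (e x) + M.γ * q x := by
        rcases min_cases Vmax (e x) with ⟨h, _⟩ | ⟨h, _⟩ <;> rw [h]
        · exact (hd x).2.trans (le_add_of_nonneg_right (mul_nonneg M.γ_nonneg (hqV x).1))
        · have h2 := abs_bellman_sub_bellman_le (M := M) hζm hζ hfk hg hfkV hgV x
          have h3 : f (k + 1) x - g x = (f (k + 1) x - M.bellman ζ (f k) x) -
            (g x - M.bellman ζ g x) + (M.bellman ζ (f k) x - M.bellman ζ g x) := by ring
          rw [h3]
          exact (abs_add_le _ _).trans (add_le_add (abs_sub _ _) h2)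
      have h4 := mul_le_mul_of_nonneg_left h1 (hζ x).1
      have h5 := mul_le_of_le_one_left (mul_nonneg M.γ_nonneg (hqV x).1) (hζ x).2
      linarith
    refine le_of_forall_pos_le_add fun τ hτ => ?_
    have hζd : Measurable fun x => ζ x * |f (k + 1) x - g x| := hζm.mul hdm
    obtain ⟨a, ha, hmax⟩ := exists_measurable_near_argmax hζd τ hτ
    have hF := mul_mem_Icc_of_filter hζ hd
    set ν := σ.bind (Kernel.id ×ₖ (Policy.ofFun a ha).kernel) with hν
    have h1 : ∫ s, maxValue ζ (fun x => |f (k + 1) x - g x|) s ∂σ ≤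
        ∫ x, ζ x * |f (k + 1) x - g x| ∂ν + τ := by
      rw [hν, integral_bind_ofFun ha hζd fun x => abs_le_of_mem_Icc (hF x)]
      have hi : Integrable (fun s => ζ (s, a s) * |f (k + 1) (s, a s) - g (s, a s)|) σ :=
        integrable_of_mem_Icc (hζd.comp (measurable_id.prodMk ha)) fun s => hF (s, a s)
      calc _ ≤ ∫ s, (ζ (s, a s) * |f (k + 1) (s, a s) - g (s, a s)| + τ) ∂σ :=
            integral_mono (integrable_of_mem_Icc (measurable_maxValue hζm hdm) (maxValue_mem hζ hd))
              (hi.add (integrable_const _)) hmax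
        _ = _ := by rw [integral_add hi (integrable_const _)]; simp
    have hwζ := mul_mem_Icc_of_filter hζ hw
    have hiw : Integrable (fun x => ζ x * min Vmax (e x)) ν :=
      integrable_of_mem_Icc (hζm.mul hwm) hwζ
    have h2 : ∫ x, ζ x * |f (k + 1) x - g x| ∂ν ≤
        ∫ x, ζ x * min Vmax (e x) ∂ν + M.γ * ∫ x, q x ∂ν := by
      have hiq : Integrable q ν := integrable_of_mem_Icc hqmeas hqV
      rw [← integral_const_mul, ← integral_add hiw (hiq.const_mul _)]
      exact integral_mono (integrable_of_mem_Icc hζd hF) (hiw.add (hiq.const_mul _)) hpt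
    have h3 := hμ σ hσ (Policy.ofFun a ha) _ hwm hw
    have h4 : ∫ x, min Vmax (e x) ∂μ ≤ ε + ε' := by
      have hi1 : Integrable (fun x => |f (k + 1) x - M.bellman ζ (f k) x|) μ :=
        (integrable_of_abs_le ((hf (k + 1) hk).sub (measurable_bellman hζm hfk))
          (abs_sub_bellman_le hV hζm hζ hfk hfkV (hfV (k + 1) hk))).abs
      have hi2 : Integrable (fun x => |g x - M.bellman ζ g x|) μ :=
        (integrable_of_abs_le (hg.sub (measurable_bellman hζm hg))
          (abs_sub_bellman_le hV hζm hζ hg hgV hgV)).abs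
      calc ∫ x, min Vmax (e x) ∂μ ≤ ∫ x, e x ∂μ :=
            integral_mono (integrable_of_mem_Icc hwm hw) (hi1.add hi2) fun x => min_le_right _ _
        _ ≤ ε + ε' := by
            rw [hedef, integral_add hi1 hi2]
            exact add_le_add (hε k (by omega)) hε'
    have h5 : ∫ x, q x ∂ν ≤ C * (ε + ε' + κ) / (1 - M.γ) + M.γ ^ k * Vmax := by
      have h6 := ih (by omega) _ (IsStateLaw.step σ (Policy.ofFun a ha) hσ)
      rwa [integral_bind_of_abs_le M.P hqm fun s => abs_le_of_mem_Icc (hq s)] at h6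
    have h7 := mul_le_mul_of_nonneg_left h5 M.γ_nonneg
    have h8 : C * (∫ x, min Vmax (e x) ∂μ + κ) ≤ C * (ε + ε' + κ) :=
      mul_le_mul_of_nonneg_left (by linarith) hC
    -- `B / (1 - γ)` is the fixed point of `x ↦ B + γ x`, so a step only adds a power of `γ` to the
    -- transient term.
    have h9 : C * (ε + ε' + κ) + M.γ * (C * (ε + ε' + κ) / (1 - M.γ) + M.γ ^ k * Vmax) =
        C * (ε + ε' + κ) / (1 - M.γ) + M.γ ^ (k + 1) * Vmax := by
      field_simp
      ring
    linarith

/-- The gap at a state is at most the filtered distance from `f (k + 1)` to `g`, plus `ζ f (k + 1) -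
Q` of the output policy at its chosen action. The second term splits into a regression error, the
distance from `f k` to `g`, and `γ` times the expected gap at the next state, so the gap satisfies a
recursion along the trajectory. -/
lemma integral_maxValue_sub_V_le (hV : M.ValuesBoundedBy Vmax) (hζm : Measurable ζ)
    (hζ : ∀ x, ζ x = 0 ∨ ζ x = 1) (hC : 0 ≤ C) (hμ : M.ConcentrateOn μ ζ C Vmax κ) (hκ : 0 ≤ κ)
    {g : S × A → ℝ} (hg : Measurable g) (hgV : ∀ x, g x ∈ Set.Icc 0 Vmax)
    {f : ℕ → S × A → ℝ} {k : ℕ} (hf : ∀ i ≤ k + 1, Measurable (f i))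
    (hfV : ∀ i ≤ k + 1, ∀ x, f i x ∈ Set.Icc 0 Vmax) {ε ε' : ℝ}
    (hε : ∀ i < k + 1, ∫ x, |f (i + 1) x - M.bellman ζ (f i) x| ∂μ ≤ ε)
    (hε' : ∫ x, |g x - M.bellman ζ g x| ∂μ ≤ ε') (hε0 : 0 ≤ ε)
    {p : S → A} (hp : Measurable p)
    (hmax : ∀ s a, ζ (s, a) * f (k + 1) (s, a) ≤ ζ (s, p s) * f (k + 1) (s, p s)) :
    ∫ s, (maxValue ζ g s - M.V (Policy.ofFun p hp) s) ∂M.ρ ≤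
      2 * (C * (ε + ε' + κ) / (1 - M.γ) + M.γ ^ (k + 1) * Vmax) / (1 - M.γ) := by
  have hγ : 0 < 1 - M.γ := by linarith [M.γ_lt_one]
  have hγ0 := M.γ_nonneg
  have hζ' : ∀ x, ζ x ∈ Set.Icc 0 1 := fun x => by rcases hζ x with h | h <;> simp [h]
  have hε'0 : 0 ≤ ε' := (integral_nonneg fun x => abs_nonneg _).trans hε'
  have hΔ := integral_maxValue_abs_sub_le hV hζm hζ' hC hμ hκ hg hgV hf hfV hε hε' hε0
  set π := Policy.ofFun p hp with hπ
  set B := C * (ε + ε' + κ) with hB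
  have hfk := hf k (by omega)
  have hfkV := hfV k (by omega)
  have hft := hf (k + 1) le_rfl
  have hftV := hfV (k + 1) le_rfl
  have hV0 : ∀ x : S × A, 0 ≤ Vmax := fun x => (hgV x).1.trans (hgV x).2
  have hgm := measurable_maxValue hζm hg
  have hgM := maxValue_mem hζ' hgV
  have hVm := measurable_V hV π
  have hVV := V_mem hV π
  -- With the positive part, `F` below is nonnegative, which settles states where the chosen action
  -- is filtered out: there `ζ f` vanishes and the value is nonnegative.
  set u : S → ℝ := fun s => max 0 (maxValue ζ g s - M.V π s) with hu
  have hum : Measurable u := measurable_const.max (hgm.sub hVm)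
  have huV : ∀ s, u s ∈ Set.Icc 0 Vmax := fun s =>
    ⟨le_max_left _ _, max_le (hV0 (s, p s)) (by linarith [(hgM s).2, (hVV s).1])⟩
  have hqm : Measurable (maxValue ζ fun x => |f k x - g x|) :=
      measurable_maxValue hζm (hfk.sub hg).abs
  have hq := maxValue_mem hζ' (abs_sub_mem_Icc hfkV hgV)
  set q : S × A → ℝ := fun x => ∫ s', maxValue ζ (fun y => |f k y - g y|) s' ∂(M.P x) with hqdef
  have hqV : ∀ x, q x ∈ Set.Icc 0 Vmax := fun x => integral_mem_Icc hqm hq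
  have hqmeas : Measurable q := measurable_integral_kernel M.P hqm
  set r : S × A → ℝ := fun x => ∫ s', u s' ∂(M.P x) with hrdef
  have hrV : ∀ x, r x ∈ Set.Icc 0 Vmax := fun x => integral_mem_Icc hum huV
  have hrm : Measurable r := measurable_integral_kernel M.P hum
  set e : S × A → ℝ := fun x => |f (k + 1) x - M.bellman ζ (f k) x| with hedef
  have hem : Measurable e := (hft.sub (measurable_bellman hζm hfk)).abs
  have hw : ∀ x, min Vmax (e x) ∈ Set.Icc 0 Vmax := fun x =>
    ⟨le_min (hV0 x) (abs_nonneg _), min_le_left _ _⟩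
  have hwm : Measurable fun x => min Vmax (e x) := measurable_const.min hem
  have hwζ := mul_mem_Icc_of_filter hζ' hw
  set F : S × A → ℝ := fun x => ζ x * min Vmax (e x) + M.γ * q x + M.γ * r x with hF
  have hF0 : ∀ x, 0 ≤ F x := fun x => add_nonneg (add_nonneg (hwζ x).1
    (mul_nonneg hγ0 (hqV x).1)) (mul_nonneg hγ0 (hrV x).1)
  have hFm : Measurable F := ((hζm.mul hwm).add (hqmeas.const_mul _)).add (hrm.const_mul _)
  have hFb : ∀ x, |F x| ≤ 3 * Vmax := by
    intro x
    rw [abs_of_nonneg (hF0 x)]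
    have h1 := mul_le_of_le_one_left (hqV x).1 M.γ_lt_one.le
    have h2 := mul_le_of_le_one_left (hrV x).1 M.γ_lt_one.le
    have h3 := (hwζ x).2
    have h4 := (hqV x).2
    have h5 := (hrV x).2
    simp only [hF]
    linarith
  have hdM := maxValue_mem hζ' (abs_sub_mem_Icc hftV hgV)
  have hdm : Measurable (maxValue ζ fun x => |f (k + 1) x - g x|) :=
    measurable_maxValue hζm (hft.sub hg).abs
  have hpt : ∀ s, u s ≤ maxValue ζ (fun x => |f (k + 1) x - g x|) s + F (s, p s) := by
    intro s
    refine max_le (add_nonneg (hdM s).1 (hF0 _)) ?_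
    have h1 := maxValue_le_add hζ' hgV hftV s
    simp only [abs_sub_comm (g _)] at h1
    have h2 : maxValue ζ (f (k + 1)) s ≤ ζ (s, p s) * f (k + 1) (s, p s) :=
      ciSup_le fun a => hmax s a
    have h3 : ζ (s, p s) * f (k + 1) (s, p s) - M.V π s ≤ F (s, p s) := by
      rw [hπ, V_ofFun hV, ← hπ]
      generalize (s, p s) = x
      rcases hζ x with h | h
      · have := (hV.2 π x).1
        rw [h, zero_mul]
        linarith [hF0 x]
      · have hTQ : M.bellman ζ g x - M.Q π x ≤ M.γ * r x := by
          rw [bellman_eq, Q_eq hV, add_sub_add_left_eq_sub, ← mul_sub, ← integral_sub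
            (integrable_of_mem_Icc hgm hgM) (integrable_of_mem_Icc hVm hVV)]
          exact mul_le_mul_of_nonneg_left (integral_mono
            ((integrable_of_mem_Icc hgm hgM).sub (integrable_of_mem_Icc hVm hVV))
            (integrable_of_mem_Icc hum huV) fun s => le_max_right _ _) hγ0
        have hfT : f (k + 1) x - M.bellman ζ g x ≤ min Vmax (e x) + M.γ * q x := by
          rcases min_cases Vmax (e x) with ⟨h, _⟩ | ⟨h, _⟩ <;> rw [h]
          · linarith [(hftV x).2, (bellman_mem hV hζm hζ' hg hgV x).1, mul_nonneg hγ0 (hqV x).1]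
          · have h4 := abs_bellman_sub_bellman_le (M := M) hζm hζ' hfk hg hfkV hgV x
            have h5 := le_abs_self (f (k + 1) x - M.bellman ζ (f k) x)
            have h6 := (abs_le.1 h4).2
            simp only [hedef, hqdef]
            linarith
        simp only [hF, h, one_mul]
        linarith
    linarith
  -- One copy bounds the distance from `f (k + 1)` to `g`; the other is `B` plus `γ` times the bound
  -- for `f k`, which adds up to the same quantity.
  set K := 2 * (B / (1 - M.γ) + M.γ ^ (k + 1) * Vmax) with hK
  have hstep : ∀ σ, M.IsStateLaw σ → ∫ s, u s ∂σ ≤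
      K + M.γ * ∫ s, u s ∂((σ.bind (Kernel.id ×ₖ π.kernel)).bind M.P) := by
    intro σ hσ
    have := hσ.isProbabilityMeasure
    set ν := σ.bind (Kernel.id ×ₖ π.kernel) with hν
    have hiw : Integrable (fun x => ζ x * min Vmax (e x)) ν :=
      integrable_of_mem_Icc (hζm.mul hwm) hwζ
    have hiq : Integrable q ν := integrable_of_mem_Icc hqmeas hqV
    have hir : Integrable r ν := integrable_of_mem_Icc hrm hrV
    have hFi : ∫ x, F x ∂ν = ∫ x, ζ x * min Vmax (e x) ∂ν + M.γ * ∫ x, q x ∂ν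
        + M.γ * ∫ x, r x ∂ν := by
      have hi : Integrable (fun x => ζ x * min Vmax (e x) + M.γ * q x) ν :=
        hiw.add (hiq.const_mul _)
      rw [← integral_const_mul, ← integral_const_mul, ← integral_add hiw (hiq.const_mul _),
        ← integral_add hi (hir.const_mul _)]
    have h1 : ∫ s, u s ∂σ ≤
        ∫ s, maxValue ζ (fun x => |f (k + 1) x - g x|) s ∂σ + ∫ x, F x ∂ν := by
      have hi2 : Integrable (fun s => F (s, p s)) σ :=
        integrable_of_abs_le (hFm.comp (measurable_id.prodMk hp)) fun s => hFb (s, p s)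
      have hi1 := integrable_of_mem_Icc (ν := σ) hdm hdM
      rw [hν, hπ, integral_bind_ofFun hp hFm hFb, ← integral_add hi1 hi2]
      exact integral_mono (integrable_of_mem_Icc hum huV) (hi1.add hi2) hpt
    have h2 := hΔ (k + 1) le_rfl σ hσ
    have h3 := hμ σ hσ π _ hwm hw
    have h4 : ∫ x, min Vmax (e x) ∂μ ≤ ε := by
      have hi1 : Integrable e μ :=
        (integrable_of_abs_le (hft.sub (measurable_bellman hζm hfk))
          (abs_sub_bellman_le hV hζm hζ' hfk hfkV hftV)).abs
      exact (integral_mono (integrable_of_mem_Icc hwm hw) hi1 fun x => min_le_right _ _).trans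
        (hε k (by omega))
    have h5 := hΔ k (by omega) _ (IsStateLaw.step σ π hσ)
    rw [integral_bind_of_abs_le M.P hqm fun s => abs_le_of_mem_Icc (hq s)] at h5
    have h6 := mul_le_mul_of_nonneg_left h5 hγ0
    have h7 : C * (∫ x, min Vmax (e x) ∂μ + κ) ≤ B :=
      mul_le_mul_of_nonneg_left (by linarith) hC
    have h8 : B + M.γ * (B / (1 - M.γ) + M.γ ^ k * Vmax) =
        B / (1 - M.γ) + M.γ ^ (k + 1) * Vmax := by
      field_simp
      ring
    rw [integral_bind_of_abs_le M.P hum fun s => abs_le_of_mem_Icc (huV s)]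
    change _ ≤ K + M.γ * ∫ x, r x ∂ν
    change M.γ * ∫ x, q x ∂ν ≤ _ at h6
    linarith
  -- Unrolling `N` steps leaves the trivial bound `u ≤ Vmax` discounted by `γ ^ N`, which vanishes
  -- in the limit.
  have hiter : ∀ N : ℕ, ∀ σ, M.IsStateLaw σ → ∫ s, u s ∂σ ≤ K / (1 - M.γ) + M.γ ^ N * Vmax := by
    intro N
    induction N with
    | zero =>
      intro σ hσ
      have := hσ.isProbabilityMeasure
      have hB0 : 0 ≤ B := by positivity
      have hV0' : 0 ≤ Vmax := by
        have h := integral_mem_Icc (ν := σ) hum huV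
        exact h.1.trans h.2
      have : 0 ≤ K / (1 - M.γ) := by positivity
      have h := (integral_mem_Icc (ν := σ) hum huV).2
      simpa using h.trans (by linarith)
    | succ N ih =>
      intro σ hσ
      have h1 := hstep σ hσ
      have h2 := mul_le_mul_of_nonneg_left (ih _ (IsStateLaw.step σ π hσ)) hγ0
      have h3 : K + M.γ * (K / (1 - M.γ) + M.γ ^ N * Vmax) =
          K / (1 - M.γ) + M.γ ^ (N + 1) * Vmax := by
        field_simp
        ring
      linarith
  have hlim : ∫ s, u s ∂M.ρ ≤ K / (1 - M.γ) := by
    have ht : Filter.Tendsto (fun N : ℕ => K / (1 - M.γ) + M.γ ^ N * Vmax) Filter.atTop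
        (nhds (K / (1 - M.γ) + 0 * Vmax)) :=
      ((tendsto_pow_atTop_nhds_zero_of_lt_one hγ0 M.γ_lt_one).mul_const _).const_add _
    rw [zero_mul, add_zero] at ht
    exact ge_of_tendsto' ht fun N => hiter N _ .init
  exact (integral_mono ((integrable_of_mem_Icc hgm hgM).sub (integrable_of_mem_Icc hVm hVV))
    (integrable_of_mem_Icc hum huV) fun s => le_max_right _ _).trans hlim

end Iterates

end MDP

end MBS

/-! ### The density filter and its change of measure. -/

namespace MBS

section Filter

variable {X : Type*} {p : X → ℝ} {b : ℝ}

lemma filter_eq_zero_or_one (p : X → ℝ) (b : ℝ) (x : X) : filter p b x = 0 ∨ filter p b x = 1 := by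
  by_cases h : b ≤ p x
  · exact Or.inr (Set.indicator_of_mem (s := {x | b ≤ p x}) h 1)
  · exact Or.inl (Set.indicator_of_notMem (s := {x | b ≤ p x}) h 1)

lemma filter_mem (p : X → ℝ) (b : ℝ) (x : X) : filter p b x ∈ Set.Icc 0 1 := by
  rcases filter_eq_zero_or_one p b x with h | h <;> simp [h]

lemma mul_filter_le (hp : ∀ x, 0 ≤ p x) (x : X) : b * filter p b x ≤ p x := by
  by_cases h : b ≤ p x
  · have : filter p b x = 1 := Set.indicator_of_mem (s := {x | b ≤ p x}) h 1
    rwa [this, mul_one]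
  · have : filter p b x = 0 := Set.indicator_of_notMem (s := {x | b ≤ p x}) h 1
    rw [this, mul_zero]
    exact hp x

lemma measurable_filter [MeasurableSpace X] (hp : Measurable p) (b : ℝ) :
    Measurable (filter p b) :=
  measurable_one.indicator (measurableSet_le measurable_const hp)

end Filter

namespace MDP

variable {S A : Type*} [MeasurableSpace S] [MeasurableSpace A] {M : MDP S A} {Vmax : ℝ}

/-- Pointwise `ζ ≤ p / b`, so a law with density at most `U` integrates `ζ * h` to at most `U / b`
times the integral of `h` under the estimate; total variation then moves this to `μ`. -/
lemma concentrateOn_filter {lam : Measure S} {μ : Measure (S × A)} [IsProbabilityMeasure μ]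
    {U b ε : ℝ} (hU : 0 ≤ U) (hb : 0 < b) {p : S × A → ℝ} (hpm : Measurable p)
    (hp : IsDensity (lam.prod Measure.count) p) (hM : M.BoundedDensities lam U)
    (hε : tvDist (densityMeasure (lam.prod Measure.count) p) μ ≤ ε) :
    M.ConcentrateOn μ (filter p b) (U / b) Vmax (Vmax * ε) := by
  intro σ hσ π h hm hV
  have := hσ.isProbabilityMeasure
  have := hp.2
  set m : Measure (S × A) := lam.prod Measure.count with hmdef
  set ν := σ.bind (Kernel.id ×ₖ π.kernel) with hν
  have hνle : ν ≤ ENNReal.ofReal U • m := by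
    obtain ⟨πs, k, hk⟩ := hσ.exists_η_eq π
    rw [hν, ← hk]
    exact hM πs k
  have hζ := mul_mem_Icc_of_filter (filter_mem p b) hV
  have hζm : Measurable fun x => filter p b x * h x := (measurable_filter hpm b).mul hm
  have hle : ∫⁻ x, ENNReal.ofReal (filter p b x * h x) ∂ν ≤
      ENNReal.ofReal (U / b) * ∫⁻ x, ENNReal.ofReal (h x) ∂(densityMeasure m p) := by
    calc ∫⁻ x, ENNReal.ofReal (filter p b x * h x) ∂ν
        ≤ ∫⁻ x, ENNReal.ofReal (filter p b x * h x) ∂(ENNReal.ofReal U • m) :=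
          lintegral_mono' hνle le_rfl
      _ = ENNReal.ofReal U * ∫⁻ x, ENNReal.ofReal (filter p b x * h x) ∂m :=
          lintegral_smul_measure _ _
      _ ≤ ENNReal.ofReal U *
          ∫⁻ x, ENNReal.ofReal (1 / b) * (ENNReal.ofReal (p x) * ENNReal.ofReal (h x)) ∂m := by
          refine mul_le_mul_right (lintegral_mono fun x => ?_) _
          rw [← ENNReal.ofReal_mul (hp.1 x), ← ENNReal.ofReal_mul (by positivity)]
          refine ENNReal.ofReal_le_ofReal ?_
          have h1 := mul_le_mul_of_nonneg_right (mul_filter_le (b := b) hp.1 x) (hV x).1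
          rw [one_div, ← div_eq_inv_mul, le_div_iff₀ hb]
          linarith
      _ = _ := by
          rw [lintegral_const_mul _ (by fun_prop), ← mul_assoc, ← ENNReal.ofReal_mul hU,
            mul_one_div, densityMeasure, lintegral_withDensity_eq_lintegral_mul _ (by fun_prop)
              (by fun_prop)]
          rfl
  rw [← ofReal_integral_eq_lintegral_ofReal (integrable_of_mem_Icc hζm hζ)
      (Filter.Eventually.of_forall fun x => (hζ x).1),
    ← ofReal_integral_eq_lintegral_ofReal (integrable_of_mem_Icc hm hV)
      (Filter.Eventually.of_forall fun x => (hV x).1), ← ENNReal.ofReal_mul (by positivity)] at hle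
  have hC : 0 ≤ U / b := by positivity
  have h2 := (ENNReal.ofReal_le_ofReal_iff
    (mul_nonneg hC (integral_nonneg fun x => (hV x).1))).1 hle
  exact h2.trans (mul_le_mul_of_nonneg_left (integral_le_add_tvDist hε hm hV) hC)

/-! ### Concentration of squared-loss differences. -/

instance isProbabilityMeasure_dataLaw (μ : Measure (S × A)) [IsProbabilityMeasure μ] :
    IsProbabilityMeasure (M.dataLaw μ) := by
  unfold dataLaw; infer_instance

variable (M) in
/-- The difference of the squared temporal-difference errors of `f` and `g` at a data point, for
the regression target built from `f'`. -/
noncomputable def lossDiff (ζ f g f' : S × A → ℝ) (z : (S × A) × (ℝ × S)) : ℝ :=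
  (f z.1 - z.2.1 - M.γ * maxValue ζ f' z.2.2) ^ 2 -
    (g z.1 - z.2.1 - M.γ * maxValue ζ f' z.2.2) ^ 2

lemma sum_lossDiff_nonpos_of_empLoss_le {n : ℕ} (hn : 0 < n) (D : Fin n → (S × A) × (ℝ × S))
    {ζ f g f' : S × A → ℝ} (h : M.empLoss D ζ f f' ≤ M.empLoss D ζ g f') :
    ∑ i, M.lossDiff ζ f g f' (D i) ≤ 0 := by
  have hn' : (0 : ℝ) < n := by exact_mod_cast hn
  have h' := (div_le_div_iff_of_pos_right hn').1 h
  simp only [lossDiff, Finset.sum_sub_distrib, maxValue]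
  linarith

section Data

variable {ζ f g f' : S × A → ℝ} {μ : Measure (S × A)} [IsProbabilityMeasure μ]

lemma ae_reward_mem (hV : M.ValuesBoundedBy Vmax) (μ : Measure (S × A)) [IsProbabilityMeasure μ] :
    ∀ᵐ z ∂(M.dataLaw μ), z.2.1 ∈ Set.Icc 0 Vmax := by
  refine Measure.ae_compProd_of_ae_ae (measurableSet_Icc.preimage (by fun_prop)) ?_
  refine Filter.Eventually.of_forall fun x => ?_
  rw [Kernel.prod_apply]
  exact Measure.quasiMeasurePreserving_fst.ae (hV.1 x)

lemma abs_lossDiff_le [Nonempty A] (hζ : ∀ x, ζ x ∈ Set.Icc 0 1) (hf'V : ∀ x, f' x ∈ Set.Icc 0 Vmax)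
    (hfV : ∀ x, f x ∈ Set.Icc 0 Vmax) (hgV : ∀ x, g x ∈ Set.Icc 0 Vmax)
    {z : (S × A) × (ℝ × S)} (hz : z.2.1 ∈ Set.Icc 0 Vmax) :
    |M.lossDiff ζ f g f' z| ≤ 4 * Vmax * |f z.1 - g z.1| := by
  have h1 := maxValue_mem hζ hf'V z.2.2
  have h2 := mul_le_of_le_one_left h1.1 M.γ_lt_one.le
  have h3 := mul_nonneg M.γ_nonneg h1.1
  have h4 : M.lossDiff ζ f g f' z = (f z.1 + g z.1 - 2 * (z.2.1 + M.γ * maxValue ζ f' z.2.2)) *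
      (f z.1 - g z.1) := by
    unfold lossDiff; ring
  rw [h4, abs_mul]
  refine mul_le_mul_of_nonneg_right (abs_le.2 ⟨?_, ?_⟩) (abs_nonneg _)
  · linarith [(hfV z.1).1, (hgV z.1).1, hz.2, h1.2]
  · linarith [(hfV z.1).2, (hgV z.1).2, hz.1, hz.2]

lemma measurable_lossDiff [Countable A] (hζm : Measurable ζ) (hf : Measurable f) (hg : Measurable g)
    (hf' : Measurable f') : Measurable (M.lossDiff ζ f g f') := by
  have := measurable_maxValue hζm hf'
  unfold lossDiff
  fun_prop

variable [Countable A] [Nonempty A]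

lemma integrable_sq_bellman_error (hV : M.ValuesBoundedBy Vmax) (hζm : Measurable ζ)
    (hζ : ∀ x, ζ x ∈ Set.Icc 0 1) (hf : Measurable f) (hf' : Measurable f')
    (hf'V : ∀ x, f' x ∈ Set.Icc 0 Vmax) (hfV : ∀ x, f x ∈ Set.Icc 0 Vmax) :
    Integrable (fun x => (f x - M.bellman ζ f' x) ^ 2) μ := by
  refine integrable_of_abs_le ((hf.sub (measurable_bellman hζm hf')).pow_const 2)
    (K := (2 * Vmax) ^ 2) fun x => ?_
  rw [abs_pow]
  exact pow_le_pow_left₀ (abs_nonneg _) (abs_sub_bellman_le hV hζm hζ hf' hf'V hfV x) 2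

/-- The square of the regression target cancels, so the difference is affine in the target, whose
conditional mean given `(s, a)` is the Bellman image of `f'`. The noise variance therefore drops
out. -/
lemma integral_lossDiff (hV : M.ValuesBoundedBy Vmax) (hζm : Measurable ζ)
    (hζ : ∀ x, ζ x ∈ Set.Icc 0 1) (hf : Measurable f) (hg : Measurable g) (hf' : Measurable f')
    (hf'V : ∀ x, f' x ∈ Set.Icc 0 Vmax)
    (hfV : ∀ x, f x ∈ Set.Icc 0 Vmax) (hgV : ∀ x, g x ∈ Set.Icc 0 Vmax)
    (hi : Integrable (M.lossDiff ζ f g f') (M.dataLaw μ)) :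
    ∫ z, M.lossDiff ζ f g f' z ∂(M.dataLaw μ) =
      l2norm μ (fun x => f x - M.bellman ζ f' x) ^ 2 -
        l2norm μ (fun x => g x - M.bellman ζ f' x) ^ 2 := by
  have hsq : ∀ k : S × A → ℝ, Measurable k → (∀ x, k x ∈ Set.Icc 0 Vmax) →
      Integrable (fun x => (k x - M.bellman ζ f' x) ^ 2) μ := fun k hk hkV =>
    integrable_sq_bellman_error hV hζm hζ hk hf' hf'V hkV
  rw [l2norm, l2norm, Real.sq_sqrt (integral_nonneg fun x => sq_nonneg _),
    Real.sq_sqrt (integral_nonneg fun x => sq_nonneg _), ← integral_sub (hsq f hf hfV)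
    (hsq g hg hgV), dataLaw, Measure.integral_compProd hi]
  refine integral_congr_ae (Filter.Eventually.of_forall fun x => ?_)
  simp only
  rw [Kernel.prod_apply]
  have hr : Integrable (fun y : ℝ × S => y.1) ((M.R x).prod (M.P x)) := by
    refine Integrable.of_bound (by fun_prop) Vmax ?_
    filter_upwards [Measure.quasiMeasurePreserving_fst.ae (hV.1 x)] with y hy
      using abs_le_of_mem_Icc hy
  have hm : Integrable (fun y : ℝ × S => maxValue ζ f' y.2) ((M.R x).prod (M.P x)) :=
    integrable_of_mem_Icc ((measurable_maxValue hζm hf').comp measurable_snd)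
      fun y => maxValue_mem hζ hf'V y.2
  have hir : ∫ y, y.1 ∂((M.R x).prod (M.P x)) = M.meanReward x := by
    have := integral_fun_fst (μ := M.R x) (ν := M.P x) (f := fun r : ℝ => r)
    simpa [meanReward] using this
  have him : ∫ y, maxValue ζ f' y.2 ∂((M.R x).prod (M.P x)) = ∫ s, maxValue ζ f' s ∂(M.P x) := by
    have := integral_fun_snd (μ := M.R x) (ν := M.P x) (f := maxValue ζ f')
    simpa using this
  have hexp : ∀ y : ℝ × S, M.lossDiff ζ f g f' (x, y) = (f x ^ 2 - g x ^ 2) -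
      2 * (f x - g x) * (y.1 + M.γ * maxValue ζ f' y.2) := by
    intro y; unfold lossDiff; ring
  simp_rw [hexp]
  have hs : Integrable (fun y : ℝ × S => y.1 + M.γ * maxValue ζ f' y.2)
      ((M.R x).prod (M.P x)) := hr.add (hm.const_mul _)
  rw [integral_sub (integrable_const _) (hs.const_mul _), integral_const_mul,
    integral_add hr (hm.const_mul _), integral_const_mul, hir, him, bellman_eq]
  simp only [integral_const, probReal_univ, one_smul]
  ring

/-- Triangle inequality through the Bellman image. It bounds the second moment of the loss
difference by the squared sum of errors, matching the factor `x + y` in the mean `x ^ 2 - y ^ 2`. -/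
lemma integral_sq_sub_le (hV : M.ValuesBoundedBy Vmax) (hζm : Measurable ζ)
    (hζ : ∀ x, ζ x ∈ Set.Icc 0 1) (hf : Measurable f) (hg : Measurable g) (hf' : Measurable f')
    (hf'V : ∀ x, f' x ∈ Set.Icc 0 Vmax)
    (hfV : ∀ x, f x ∈ Set.Icc 0 Vmax) (hgV : ∀ x, g x ∈ Set.Icc 0 Vmax) :
    ∫ x, (f x - g x) ^ 2 ∂μ ≤ 2 * (l2norm μ (fun x => f x - M.bellman ζ f' x) +
        l2norm μ (fun x => g x - M.bellman ζ f' x)) ^ 2 := by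
  have hsq : ∀ k : S × A → ℝ, Measurable k → (∀ x, k x ∈ Set.Icc 0 Vmax) →
      Integrable (fun x => (k x - M.bellman ζ f' x) ^ 2) μ := fun k hk hkV =>
    integrable_sq_bellman_error hV hζm hζ hk hf' hf'V hkV
  have hd : Integrable (fun x => (f x - g x) ^ 2) μ := by
    refine integrable_of_abs_le ((hf.sub hg).pow_const 2) (K := Vmax ^ 2) fun x => ?_
    rw [abs_pow]
    exact pow_le_pow_left₀ (abs_nonneg _) (abs_sub_mem_Icc hfV hgV x).2 2
  have h1 : ∫ x, (f x - g x) ^ 2 ∂μ ≤ ∫ x, (2 * (f x - M.bellman ζ f' x) ^ 2 +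
      2 * (g x - M.bellman ζ f' x) ^ 2) ∂μ := by
    refine integral_mono hd (((hsq f hf hfV).const_mul 2).add ((hsq g hg hgV).const_mul 2))
      fun x => ?_
    nlinarith [sq_nonneg (f x - M.bellman ζ f' x + (g x - M.bellman ζ f' x))]
  rw [integral_add ((hsq f hf hfV).const_mul 2) ((hsq g hg hgV).const_mul 2),
    integral_const_mul, integral_const_mul] at h1
  have hx : l2norm μ (fun x => f x - M.bellman ζ f' x) ^ 2 =
      ∫ x, (f x - M.bellman ζ f' x) ^ 2 ∂μ :=
    Real.sq_sqrt (integral_nonneg fun x => sq_nonneg _)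
  have hy : l2norm μ (fun x => g x - M.bellman ζ f' x) ^ 2 =
      ∫ x, (g x - M.bellman ζ f' x) ^ 2 ∂μ :=
    Real.sq_sqrt (integral_nonneg fun x => sq_nonneg _)
  have hx0 : 0 ≤ l2norm μ (fun x => f x - M.bellman ζ f' x) := Real.sqrt_nonneg _
  have hy0 : 0 ≤ l2norm μ (fun x => g x - M.bellman ζ f' x) := Real.sqrt_nonneg _
  nlinarith [mul_nonneg hx0 hy0]

/-- A function whose Bellman error exceeds that of a competitor by `d` has the smaller empirical
loss with probability exponentially small in `n d² / Vmax²`. -/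
lemma measure_sum_lossDiff_nonpos_le (hV : M.ValuesBoundedBy Vmax) (hζm : Measurable ζ)
    (hζ : ∀ x, ζ x ∈ Set.Icc 0 1) (hf : Measurable f) (hg : Measurable g) (hf' : Measurable f')
    (hf'V : ∀ x, f' x ∈ Set.Icc 0 Vmax)
    (hfV : ∀ x, f x ∈ Set.Icc 0 Vmax) (hgV : ∀ x, g x ∈ Set.Icc 0 Vmax) (hV0 : 0 < Vmax) (n : ℕ)
    (hlt : l2norm μ (fun x => g x - M.bellman ζ f' x) <
      l2norm μ (fun x => f x - M.bellman ζ f' x)) :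
    (Measure.pi fun _ : Fin n => M.dataLaw μ).real
        {D | ∑ i, M.lossDiff ζ f g f' (D i) ≤ 0} ≤
      Real.exp (-(n * ((l2norm μ (fun x => f x - M.bellman ζ f' x) -
        l2norm μ (fun x => g x - M.bellman ζ f' x)) ^ 2 / (128 * Vmax ^ 2)))) := by
  have hYm : Measurable (M.lossDiff ζ f g f') := measurable_lossDiff hζm hf hg hf'
  have hY1 : ∀ᵐ z ∂(M.dataLaw μ), |M.lossDiff ζ f g f' z| ≤ 4 * Vmax * |f z.1 - g z.1| := by
    filter_upwards [ae_reward_mem hV μ] with z hz using abs_lossDiff_le hζ hf'V hfV hgV hz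
  have hY2 : ∀ᵐ z ∂(M.dataLaw μ), |M.lossDiff ζ f g f' z| ≤ 4 * Vmax ^ 2 := by
    filter_upwards [hY1] with z hz
    refine hz.trans ?_
    rw [pow_two, ← mul_assoc]
    exact mul_le_mul_of_nonneg_left (abs_sub_mem_Icc hfV hgV z.1).2 (by positivity)
  have hYi : Integrable (M.lossDiff ζ f g f') (M.dataLaw μ) :=
    Integrable.of_bound hYm.aestronglyMeasurable _ hY2
  have hYi2 : Integrable (fun z => M.lossDiff ζ f g f' z ^ 2) (M.dataLaw μ) := by
    refine Integrable.of_bound (hYm.pow_const 2).aestronglyMeasurable ((4 * Vmax ^ 2) ^ 2) ?_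
    filter_upwards [hY2] with z hz
    rw [Real.norm_eq_abs, abs_pow]
    exact pow_le_pow_left₀ (abs_nonneg _) hz 2
  have hmean := integral_lossDiff (μ := μ) hV hζm hζ hf hg hf' hf'V hfV hgV hYi
  have hsub := integral_sq_sub_le (μ := μ) hV hζm hζ hf hg hf' hf'V hfV hgV
  have hsec : ∫ z, M.lossDiff ζ f g f' z ^ 2 ∂(M.dataLaw μ) ≤
      16 * Vmax ^ 2 * ∫ x, (f x - g x) ^ 2 ∂μ := by
    have hd : Integrable (fun z : (S × A) × (ℝ × S) => 16 * Vmax ^ 2 * (f z.1 - g z.1) ^ 2)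
        (M.dataLaw μ) := by
      refine integrable_of_abs_le (by fun_prop) (K := 16 * Vmax ^ 2 * Vmax ^ 2) fun z => ?_
      rw [abs_mul, abs_of_nonneg (by positivity : 0 ≤ 16 * Vmax ^ 2), abs_pow]
      exact mul_le_mul_of_nonneg_left (pow_le_pow_left₀ (abs_nonneg _)
        (abs_sub_mem_Icc hfV hgV z.1).2 2) (by positivity)
    calc _ ≤ ∫ z, 16 * Vmax ^ 2 * (f z.1 - g z.1) ^ 2 ∂(M.dataLaw μ) := by
          refine integral_mono_ae hYi2 hd ?_
          filter_upwards [hY1] with z hz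
          have := pow_le_pow_left₀ (abs_nonneg _) hz 2
          rw [sq_abs, mul_pow, sq_abs] at this
          linarith
      _ = _ := by
          rw [dataLaw] at hd ⊢
          rw [Measure.integral_compProd hd, ← integral_const_mul]
          simp
  set x := l2norm μ (fun x => f x - M.bellman ζ f' x) with hx
  set y := l2norm μ (fun x => g x - M.bellman ζ f' x) with hy
  have hy0 : 0 ≤ y := Real.sqrt_nonneg _
  have hxy : 0 < x + y := by linarith
  -- The maximizer of `l * (x ^ 2 - y ^ 2) - l ^ 2 * (32 * Vmax ^ 2 * (x + y) ^ 2)`. The factor `x +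
  -- y` cancels from the optimum, leaving an exponent quadratic in `x - y`.
  set l := (x - y) / (64 * Vmax ^ 2 * (x + y)) with hl
  have hl0 : 0 ≤ l := div_nonneg (by linarith) (by positivity)
  have hl1 : l ≤ 1 / (64 * Vmax ^ 2) := by
    rw [hl, div_le_div_iff₀ (by positivity) (by positivity)]
    nlinarith [mul_nonneg (sq_nonneg Vmax) hy0]
  have hb : ∀ᵐ z ∂(M.dataLaw μ), |l * M.lossDiff ζ f g f' z| ≤ 1 := by
    filter_upwards [hY2] with z hz
    rw [abs_mul, abs_of_nonneg hl0]
    calc l * |M.lossDiff ζ f g f' z| ≤ 1 / (64 * Vmax ^ 2) * (4 * Vmax ^ 2) :=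
          mul_le_mul hl1 hz (abs_nonneg _) (by positivity)
      _ ≤ 1 := by field_simp; norm_num
  refine (measure_sum_nonpos_le (M.dataLaw μ) n hYm hl0 hb hYi hYi2).trans ?_
  refine Real.exp_le_exp.2 (neg_le_neg (mul_le_mul_of_nonneg_left ?_ (Nat.cast_nonneg n)))
  have h1 : ∫ z, M.lossDiff ζ f g f' z ^ 2 ∂(M.dataLaw μ) ≤ 32 * Vmax ^ 2 * (x + y) ^ 2 := by
    have := mul_le_mul_of_nonneg_left hsub (by positivity : 0 ≤ 16 * Vmax ^ 2)
    linarith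
  have h2 := mul_le_mul_of_nonneg_left h1 (sq_nonneg l)
  have h3 : l * (x ^ 2 - y ^ 2) - l ^ 2 * (32 * Vmax ^ 2 * (x + y) ^ 2) =
      (x - y) ^ 2 / (128 * Vmax ^ 2) := by
    rw [hl]
    field_simp
    ring
  rw [hmean]
  linarith

end Data

end MDP

end MBS

/-! ### The deterministic suboptimality bound. -/

namespace MBS

namespace MDP

variable {S A : Type*} [MeasurableSpace S] [MeasurableSpace A] {M : MDP S A} {Vmax : ℝ}
  {ζ : S × A → ℝ}

lemma isFiniteMeasure_occupancy (π : Policy S A) : IsFiniteMeasure (M.occupancy π) := by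
  refine ⟨?_⟩
  rw [occupancy, Measure.sum_apply _ MeasurableSet.univ]
  have hγ : 0 ≤ 1 - M.γ := by linarith [M.γ_lt_one]
  simp only [Measure.smul_apply, measure_univ, smul_eq_mul, mul_one]
  rw [← ENNReal.ofReal_tsum_of_nonneg
    (fun h => mul_nonneg hγ (pow_nonneg M.γ_nonneg h))
    ((summable_geometric_of_lt_one M.γ_nonneg M.γ_lt_one).mul_left _)]
  exact ENNReal.ofReal_lt_top

/-- The `h = 0` term of the occupancy series has weight `1 - γ`; this is the source of the factor `1
/ (1 - γ)` on `εζ`. -/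
lemma initial_real_le_occupancy_real (π : Policy S A) {Z : Set (S × A)} (hZ : MeasurableSet Z) :
    (1 - M.γ) * (M.ρ.bind (Kernel.id ×ₖ π.kernel)).real Z ≤ (M.occupancy π).real Z := by
  have := M.isFiniteMeasure_occupancy π
  have hγ : 0 ≤ 1 - M.γ := by linarith [M.γ_lt_one]
  have h : ENNReal.ofReal (1 - M.γ) * (M.ρ.bind (Kernel.id ×ₖ π.kernel)) Z ≤
      M.occupancy π Z := by
    rw [occupancy, Measure.sum_apply _ hZ]
    refine le_trans (le_of_eq ?_) (ENNReal.le_tsum 0)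
    simp [η, lawFromState]
  rw [← ENNReal.toReal_ofReal hγ, measureReal_def, measureReal_def, ← ENNReal.toReal_mul]
  exact ENNReal.toReal_mono (measure_ne_top _ _) h

/-- A policy in the constrained set gains little over the filtered greedy value of its own
`Q`-function. -/
lemma value_le_integral_maxValue [Countable A] [Nonempty A] (hV : M.ValuesBoundedBy Vmax)
    (hV0 : 0 ≤ Vmax) (hζm : Measurable ζ) (hζ : ∀ x, ζ x = 0 ∨ ζ x = 1) {εζ : ℝ} {π : Policy S A}
    (hπ : π ∈ M.constrainedPolicies ζ εζ) :
    M.value π ≤ ∫ s, maxValue ζ (M.Q π) s ∂M.ρ + Vmax * (εζ / (1 - M.γ)) := by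
  have hγ : 0 < 1 - M.γ := by linarith [M.γ_lt_one]
  have hζ' : ∀ x, ζ x ∈ Set.Icc 0 1 := fun x => by rcases hζ x with h | h <;> simp [h]
  have hQm := measurable_Q hV π
  have hmm := measurable_maxValue hζm hQm
  have hmM := maxValue_mem hζ' (hV.2 π)
  set Z : Set (S × A) := {x | ζ x = 0} with hZdef
  have hZ : MeasurableSet Z := hζm (measurableSet_singleton 0)
  set ν := M.ρ.bind (Kernel.id ×ₖ π.kernel) with hν
  have h1 : M.value π = ∫ x, M.Q π x ∂ν := by
    rw [value, hν, integral_bind_of_abs_le _ hQm fun x => abs_le_of_mem_Icc (hV.2 π x)]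
    refine integral_congr_ae (Filter.Eventually.of_forall fun s => ?_)
    simp only
    rw [V_eq_integral_Q hV π s hQm, integral_id_prod _ hQm]
  have hm1 : Measurable fun x : S × A => maxValue ζ (M.Q π) x.1 := hmm.comp measurable_fst
  have h2 : ∫ x, maxValue ζ (M.Q π) x.1 ∂ν = ∫ s, maxValue ζ (M.Q π) s ∂M.ρ := by
    rw [hν, integral_bind_of_abs_le _ hm1 fun x => abs_le_of_mem_Icc (hmM x.1)]
    refine integral_congr_ae (Filter.Eventually.of_forall fun s => ?_)
    simp only
    rw [integral_id_prod _ hm1]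
    simp
  have hi1 : Integrable (fun x : S × A => maxValue ζ (M.Q π) x.1) ν :=
    integrable_of_mem_Icc hm1 fun x => hmM x.1
  have hi2 : Integrable (Z.indicator fun _ => Vmax) ν := (integrable_const _).indicator hZ
  have h3 : ∫ x, M.Q π x ∂ν ≤ ∫ x, (maxValue ζ (M.Q π) x.1 + Z.indicator (fun _ => Vmax) x) ∂ν := by
    refine integral_mono (integrable_of_mem_Icc hQm (hV.2 π)) (hi1.add hi2) fun x => ?_
    simp only
    rcases hζ x with h | h
    · rw [Set.indicator_of_mem (show x ∈ Z from h)]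
      linarith [(hV.2 π x).2, (hmM x.1).1]
    · have h4 := le_maxValue hζ' (hV.2 π) x.1 x.2
      rw [Prod.mk.eta, h, one_mul] at h4
      have h5 : 0 ≤ Z.indicator (fun _ => Vmax) x := Set.indicator_nonneg (fun _ _ => hV0) x
      linarith
  rw [integral_add hi1 hi2, h2, integral_indicator_const _ hZ, smul_eq_mul, mul_comm] at h3
  rw [h1]
  refine h3.trans (add_le_add_right (mul_le_mul_of_nonneg_left ?_ hV0) _)
  rw [le_div_iff₀ hγ, mul_comm]
  exact (initial_real_le_occupancy_real π hZ).trans hπ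

/-- The suboptimality bound of filtered fitted `Q`-iteration in terms of its regression errors. -/
lemma value_sub_value_le [Countable A] [Nonempty A] [DiscreteMeasurableSpace A]
    {μ : Measure (S × A)} [IsProbabilityMeasure μ] {C κ : ℝ} (hV : M.ValuesBoundedBy Vmax)
    (hV0 : 0 ≤ Vmax) (hζm : Measurable ζ)
    (hζ : ∀ x, ζ x = 0 ∨ ζ x = 1) (hC : 0 ≤ C) (hμ : M.ConcentrateOn μ ζ C Vmax κ) (hκ : 0 ≤ κ)
    {f : ℕ → S × A → ℝ} {t : ℕ} (ht : 1 ≤ t) (hf : ∀ i ≤ t, Measurable (f i))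
    (hfV : ∀ i ≤ t, ∀ x, f i x ∈ Set.Icc 0 Vmax) {ε εζ : ℝ}
    (hε : ∀ i < t, l2norm μ (fun x => f (i + 1) x - M.bellman ζ (f i) x) ≤ ε) (hε0 : 0 ≤ ε)
    {p : S → A} (hp : Measurable p)
    (hmax : ∀ s a, ζ (s, a) * f t (s, a) ≤ ζ (s, p s) * f t (s, p s))
    {π : Policy S A} (hπ : π ∈ M.constrainedPolicies ζ εζ) :
    M.value π - M.value (Policy.ofFun p hp) ≤
      2 * C / (1 - M.γ) ^ 2 *
        (ε + κ + l2norm μ (fun x => M.Q π x - M.bellman ζ (M.Q π) x)) +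
      (2 * M.γ ^ t + εζ) * Vmax / (1 - M.γ) := by
  obtain ⟨k, rfl⟩ : ∃ k, t = k + 1 := ⟨t - 1, by omega⟩
  have hγ : 0 < 1 - M.γ := by linarith [M.γ_lt_one]
  have hζ' : ∀ x, ζ x ∈ Set.Icc 0 1 := fun x => by rcases hζ x with h | h <;> simp [h]
  have hQm := measurable_Q hV π
  have h1 := value_le_integral_maxValue hV hV0 hζm hζ hπ
  have h2 := integral_maxValue_sub_V_le hV hζm hζ hC hμ hκ hQm (hV.2 π) hf hfV
    (fun i hi => (integral_abs_le_l2norm μ ((hf (i + 1) (by omega)).sub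
      (measurable_bellman hζm (hf i hi.le))) (abs_sub_bellman_le hV hζm hζ' (hf i hi.le)
        (hfV i hi.le) (hfV (i + 1) (by omega)))).trans (hε i hi))
    (integral_abs_le_l2norm μ (hQm.sub (measurable_bellman hζm hQm))
      (abs_sub_bellman_le hV hζm hζ' hQm (hV.2 π) (hV.2 π))) hε0 hp hmax
  rw [integral_sub (integrable_of_mem_Icc (measurable_maxValue hζm hQm)
      (maxValue_mem hζ' (hV.2 π)))
    (integrable_of_mem_Icc (measurable_V hV _) (V_mem hV _))] at h2
  change _ - M.value _ ≤ _ at h2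
  refine (show _ ≤ _ by linarith : _ ≤ 2 * (C * (ε + l2norm μ (fun x => M.Q π x -
    M.bellman ζ (M.Q π) x) + κ) / (1 - M.γ) + M.γ ^ (k + 1) * Vmax) / (1 - M.γ) +
      Vmax * (εζ / (1 - M.γ))).trans (le_of_eq ?_)
  field_simp
  ring

/-! ### Joint measurability in the random filter, and the tail bound for one triple. -/

section RandomFilter

variable {W : Type*} [MeasurableSpace W] {μhat : W → S × A → ℝ} [Countable A]

lemma measurable_maxValue_random (hμ : Measurable (Function.uncurry μhat)) (b : ℝ)
    {f : S × A → ℝ} (hf : Measurable f) :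
    Measurable fun ws : W × S => maxValue (filter (μhat ws.1) b) f ws.2 := by
  refine Measurable.iSup fun a => ?_
  have h : Measurable fun ws : W × S => (ws.1, (ws.2, a)) := by fun_prop
  have h1 := (measurable_filter hμ b).comp h
  have h2 : Measurable fun ws : W × S => f (ws.2, a) := hf.comp (by fun_prop)
  exact h1.mul h2

lemma measurable_lossDiff_random (hμ : Measurable (Function.uncurry μhat)) (b : ℝ)
    {f g f' : S × A → ℝ} (hf : Measurable f) (hg : Measurable g) (hf' : Measurable f') :
    Measurable fun wz : W × ((S × A) × (ℝ × S)) =>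
      M.lossDiff (filter (μhat wz.1) b) f g f' wz.2 := by
  have h : Measurable fun wz : W × ((S × A) × (ℝ × S)) =>
      maxValue (filter (μhat wz.1) b) f' wz.2.2.2 :=
    (measurable_maxValue_random hμ b hf').comp
      (g := fun ws : W × S => maxValue (filter (μhat ws.1) b) f' ws.2)
      (f := fun wz : W × ((S × A) × (ℝ × S)) => (wz.1, wz.2.2.2)) (by fun_prop)
  unfold lossDiff
  fun_prop

lemma measurable_l2norm_bellman_random (hμ : Measurable (Function.uncurry μhat)) (b : ℝ)
    (μ : Measure (S × A)) [IsProbabilityMeasure μ] {f f' : S × A → ℝ} (hf : Measurable f)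
    (hf' : Measurable f') :
    Measurable fun w => l2norm μ (fun x => f x - M.bellman (filter (μhat w) b) f' x) := by
  have hT : Measurable fun wx : W × (S × A) =>
      ∫ s, maxValue (filter (μhat wx.1) b) f' s ∂(M.P wx.2) := by
    have h := (measurable_maxValue_random hμ b hf').comp
      (f := fun y : (W × (S × A)) × S => (y.1.1, y.2)) (by fun_prop)
    exact (h.stronglyMeasurable.integral_kernel_prod_right'
      (κ := Kernel.prodMkLeft W M.P)).measurable
  have hr := M.measurable_meanReward
  have hsq : Measurable fun wx : W × (S × A) =>
      (f wx.2 - M.bellman (filter (μhat wx.1) b) f' wx.2) ^ 2 := by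
    simp only [bellman_eq]
    fun_prop
  exact (hsq.stronglyMeasurable.integral_prod_right' (ν := μ)).measurable.sqrt

end RandomFilter

/-- If `f` has a markedly larger Bellman error than `g`, it is unlikely to have the smaller
empirical loss. -/
lemma measure_misranked_le [Countable A] [Nonempty A] {f g f' : S × A → ℝ} {μ : Measure (S × A)}
    [IsProbabilityMeasure μ] (hV : M.ValuesBoundedBy Vmax) (hV0 : 0 ≤ Vmax) (hζm : Measurable ζ)
    (hζ : ∀ x, ζ x ∈ Set.Icc 0 1) (hf : Measurable f) (hg : Measurable g) (hf' : Measurable f')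
    (hf'V : ∀ x, f' x ∈ Set.Icc 0 Vmax)
    (hfV : ∀ x, f x ∈ Set.Icc 0 Vmax) (hgV : ∀ x, g x ∈ Set.Icc 0 Vmax)
    {n : ℕ} (hn : 0 < n) {q : ℝ} (hq : 1 ≤ q) :
    (Measure.pi fun _ : Fin n => M.dataLaw μ)
        {D | l2norm μ (fun x => g x - M.bellman ζ f' x) + 20 * √(Vmax ^ 2 * Real.log q / n) <
            l2norm μ (fun x => f x - M.bellman ζ f' x) ∧
          ∑ i, M.lossDiff ζ f g f' (D i) ≤ 0} ≤ ENNReal.ofReal (q⁻¹ ^ 3) := by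
  set x := l2norm μ (fun x => f x - M.bellman ζ f' x) with hx
  set y := l2norm μ (fun x => g x - M.bellman ζ f' x) with hy
  set u := √(Vmax ^ 2 * Real.log q / n) with hu
  have hn' : (0 : ℝ) < n := by exact_mod_cast hn
  have hL : 0 ≤ Real.log q := Real.log_nonneg hq
  have hu0 : 0 ≤ u := Real.sqrt_nonneg _
  have hu2 : u ^ 2 = Vmax ^ 2 * Real.log q / n := Real.sq_sqrt (by positivity)
  by_cases hlt : y + 20 * u < x
  swap
  · simp [hlt]
  -- If `Vmax = 0` the two functions coincide, contradicting the strict separation of their errors.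
  have hVpos : 0 < Vmax := by
    refine hV0.lt_of_ne' fun h0 => ?_
    have : f = g := funext fun z => by
      have h1 := hfV z
      have h2 := hgV z
      rw [h0] at h1 h2
      linarith [h1.1, h1.2, h2.1, h2.2]
    have : x = y := by rw [hx, hy, this]
    linarith
  have h := measure_sum_lossDiff_nonpos_le (μ := μ) hV hζm hζ hf hg hf' hf'V hfV hgV hVpos n
    (by linarith)
  rw [← hx, ← hy] at h
  simp only [hlt, true_and]
  rw [← ofReal_measureReal]
  refine ENNReal.ofReal_le_ofReal (h.trans ?_)
  have hq' : q⁻¹ ^ 3 = Real.exp (-(3 * Real.log q)) := by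
    rw [Real.exp_neg, inv_pow, mul_comm, Real.exp_mul, Real.exp_log (by linarith)]
    norm_cast
  rw [hq']
  refine Real.exp_le_exp.2 (neg_le_neg ?_)
  -- The constant `20` is chosen so that `400 / 128 ≥ 3`: the cube of `q⁻¹` pays for a union over
  -- triples.
  have h1 : (20 * u) ^ 2 ≤ (x - y) ^ 2 := pow_le_pow_left₀ (by positivity) (by linarith) 2
  rw [mul_pow, hu2] at h1
  rw [← mul_div_assoc, le_div_iff₀ (by positivity)]
  have h2 := mul_le_mul_of_nonneg_left h1 hn'.le
  have h3 : (n : ℝ) * (20 ^ 2 * (Vmax ^ 2 * Real.log q / n)) = 400 * (Vmax ^ 2 * Real.log q) := by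
    field_simp
    ring
  rw [h3] at h2
  nlinarith [mul_nonneg (sq_nonneg Vmax) hL]

end MDP

end MBS

/-! ### The uniform ranking event and its probability. -/

namespace MBS

namespace MDP

/-- For negative `U` the dominating measure would be zero, yet it dominates a probability measure.
-/
lemma BoundedDensities.nonneg {S A : Type*} [MeasurableSpace S] [MeasurableSpace A]
    {M : MDP S A} {lam : Measure S} {U : ℝ} (h : M.BoundedDensities lam U) (π : Policy S A) :
    0 ≤ U := by
  by_contra hU
  have h1 := h (fun _ => π) 0
  rw [ENNReal.ofReal_of_nonpos (not_le.1 hU).le, zero_smul] at h1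
  have h2 := h1 Set.univ
  simp at h2

section GoodEvent

variable {S A : Type*} [MeasurableSpace S] [MeasurableSpace A] {W : Type*} [MeasurableSpace W]

/-- The event that the empirical loss ranks every pair of functions in `F` correctly, up to a
slack `τ` in the Bellman error. -/
def wellRanked (M : MDP S A) (μ : Measure (S × A)) (F : Finset (S × A → ℝ))
    (μhat : W → S × A → ℝ) (b τ : ℝ) (n : ℕ) : Set (W × (Fin n → (S × A) × (ℝ × S))) :=
  {ω | ∀ x ∈ F ×ˢ (F ×ˢ F),
    ¬ (l2norm μ (fun y => x.2.1 y - M.bellman (filter (μhat ω.1) b) x.2.2 y) + τ <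
        l2norm μ (fun y => x.1 y - M.bellman (filter (μhat ω.1) b) x.2.2 y) ∧
      ∑ i, M.lossDiff (filter (μhat ω.1) b) x.1 x.2.1 x.2.2 (ω.2 i) ≤ 0)}

variable [Countable A] {M : MDP S A} {μ : Measure (S × A)} [IsProbabilityMeasure μ]
  {F : Finset (S × A → ℝ)} {μhat : W → S × A → ℝ} {b Vmax : ℝ} {n : ℕ}

lemma measurableSet_misranked (hμ : Measurable (Function.uncurry μhat)) {f g f' : S × A → ℝ}
    (hf : Measurable f) (hg : Measurable g) (hf' : Measurable f') (τ : ℝ) :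
    MeasurableSet {ω : W × (Fin n → (S × A) × (ℝ × S)) |
      l2norm μ (fun y => g y - M.bellman (filter (μhat ω.1) b) f' y) + τ <
        l2norm μ (fun y => f y - M.bellman (filter (μhat ω.1) b) f' y) ∧
      ∑ i, M.lossDiff (filter (μhat ω.1) b) f g f' (ω.2 i) ≤ 0} := by
  have h0 : Measurable (Prod.fst : W × (Fin n → (S × A) × (ℝ × S)) → W) := measurable_fst
  have h1 := (measurable_l2norm_bellman_random (M := M) hμ b μ hg hf').comp h0
  have h2 := (measurable_l2norm_bellman_random (M := M) hμ b μ hf hf').comp h0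
  have h3 : Measurable fun ω : W × (Fin n → (S × A) × (ℝ × S)) =>
      ∑ i, M.lossDiff (filter (μhat ω.1) b) f g f' (ω.2 i) :=
    Finset.measurable_fun_sum _ fun i _ =>
      (measurable_lossDiff_random (M := M) hμ b hf hg hf').comp
        (f := fun ω : W × (Fin n → (S × A) × (ℝ × S)) => (ω.1, ω.2 i)) (by fun_prop)
  exact (measurableSet_lt (h1.add_const τ) h2).inter (measurableSet_le h3 measurable_const)

lemma measurableSet_wellRanked (hμ : Measurable (Function.uncurry μhat))
    (hF : ∀ f ∈ F, Measurable f) (τ : ℝ) :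
    MeasurableSet (M.wellRanked μ F μhat b τ n) := by
  have : M.wellRanked μ F μhat b τ n = ⋂ x ∈ F ×ˢ (F ×ˢ F), {ω |
      l2norm μ (fun y => x.2.1 y - M.bellman (filter (μhat ω.1) b) x.2.2 y) + τ <
        l2norm μ (fun y => x.1 y - M.bellman (filter (μhat ω.1) b) x.2.2 y) ∧
      ∑ i, M.lossDiff (filter (μhat ω.1) b) x.1 x.2.1 x.2.2 (ω.2 i) ≤ 0}ᶜ := by
    ext ω
    simp only [wellRanked, Set.mem_iInter, Set.mem_compl_iff, Set.mem_ofPred_eq]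
  rw [this]
  refine Finset.measurableSet_biInter _ fun x hx => ?_
  simp only [Finset.mem_product] at hx
  exact (measurableSet_misranked hμ (hF _ hx.1) (hF _ hx.2.1) (hF _ hx.2.2) τ).compl

lemma measure_compl_wellRanked_le [Nonempty A] (Pw : Measure W) [IsProbabilityMeasure Pw]
    (hV : M.ValuesBoundedBy Vmax) (hV0 : 0 ≤ Vmax) (hμ : Measurable (Function.uncurry μhat))
    (hF : ∀ f ∈ F, Measurable f ∧ ∀ x, f x ∈ Set.Icc 0 Vmax) (hn : 0 < n) {δ : ℝ} (hδ : 0 < δ)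
    (hδ1 : δ < 1) :
    (Pw.prod (Measure.pi fun _ : Fin n => M.dataLaw μ))
      (M.wellRanked μ F μhat b (20 * √(Vmax ^ 2 * Real.log (F.card / δ) / n)) n)ᶜ ≤
        ENNReal.ofReal δ := by
  set τ := 20 * √(Vmax ^ 2 * Real.log (F.card / δ) / n) with hτ
  set E : (S × A → ℝ) × ((S × A → ℝ) × (S × A → ℝ)) →
    Set (W × (Fin n → (S × A) × (ℝ × S))) := fun x => {ω |
      l2norm μ (fun y => x.2.1 y - M.bellman (filter (μhat ω.1) b) x.2.2 y) + τ <
        l2norm μ (fun y => x.1 y - M.bellman (filter (μhat ω.1) b) x.2.2 y) ∧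
      ∑ i, M.lossDiff (filter (μhat ω.1) b) x.1 x.2.1 x.2.2 (ω.2 i) ≤ 0} with hE
  have hsub : (M.wellRanked μ F μhat b τ n)ᶜ ⊆ ⋃ x ∈ F ×ˢ (F ×ˢ F), E x := by
    intro ω hω
    simp only [wellRanked, Set.mem_compl_iff, Set.mem_ofPred_eq, not_forall, not_not] at hω
    obtain ⟨x, hx, h⟩ := hω
    exact Set.mem_biUnion (show x ∈ (↑(F ×ˢ (F ×ˢ F)) : Set _) from hx) h
  have hEx : ∀ x ∈ F ×ˢ (F ×ˢ F), (Pw.prod (Measure.pi fun _ : Fin n => M.dataLaw μ)) (E x) ≤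
      ENNReal.ofReal ((F.card / δ : ℝ)⁻¹ ^ 3) := by
    intro x hx
    simp only [Finset.mem_product] at hx
    have hcard : (1 : ℝ) ≤ F.card := by
      exact_mod_cast Finset.card_pos.2 ⟨x.1, hx.1⟩
    have hq : 1 ≤ (F.card / δ : ℝ) := by
      rw [le_div_iff₀ hδ]; linarith
    have h1 := hF _ hx.1
    have h2 := hF _ hx.2.1
    have h3 := hF _ hx.2.2
    -- Independence enters here: slicing at a fixed `w` makes the filter deterministic with respect
    -- to the data.
    rw [Measure.prod_apply (measurableSet_misranked hμ h1.1 h2.1 h3.1 τ)]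
    calc _ ≤ ∫⁻ _, ENNReal.ofReal ((F.card / δ : ℝ)⁻¹ ^ 3) ∂Pw := by
          refine lintegral_mono fun w => ?_
          exact measure_misranked_le hV hV0 (measurable_filter hμ.of_uncurry_left b)
            (filter_mem _ b) h1.1 h2.1 h3.1 h3.2 h1.2 h2.2 hn hq
      _ = _ := by simp
  refine (measure_mono hsub).trans ((measure_biUnion_finset_le _ _).trans
    ((Finset.sum_le_sum hEx).trans ?_))
  rw [Finset.sum_const, Finset.card_product, Finset.card_product, nsmul_eq_mul,
    ← ENNReal.ofReal_natCast, ← ENNReal.ofReal_mul (Nat.cast_nonneg _)]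
  refine ENNReal.ofReal_le_ofReal ?_
  push_cast
  rcases Nat.eq_zero_or_pos F.card with h0 | h0
  · simp [h0, hδ.le]
  · have : (0 : ℝ) < F.card := by exact_mod_cast h0
    -- There are `F.card ^ 3` triples, each of probability at most `(δ / F.card) ^ 3`.
    have h : (F.card : ℝ) * (F.card * F.card) * (F.card / δ : ℝ)⁻¹ ^ 3 = δ ^ 3 := by
      field_simp
    rw [h]
    exact pow_le_of_le_one hδ.le hδ1.le (by norm_num)

end GoodEvent

end MDP

end MBS

/-! ### Combining the deterministic bound with the probabilistic events. -/

theorem theorem2 :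
    ∃ c : ℝ, 0 < c ∧
    ∀ {S A : Type*} [MeasurableSpace S] [MeasurableSpace A] [Countable A]
      [DiscreteMeasurableSpace A]
      -- the MDP, the reference measure for densities on states, the data distribution
      (M : MBS.MDP S A) (lam : Measure S) [SigmaFinite lam]
      (μ : Measure (S × A)) [IsProbabilityMeasure μ]
      (Vmax U b δ εμ εF εζ : ℝ) (n : ℕ)
      -- the function class
      (F : Finset (S × A → ℝ))
      -- the density estimate: a random density, with source of randomness `(W, Pw)`
      {W : Type*} [MeasurableSpace W] (Pw : Measure W) [IsProbabilityMeasure Pw]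
      (μhat : W → S × A → ℝ),
      0 < n → 0 < b → 0 < δ → δ < 1 →
      M.ValuesBoundedBy Vmax →
      (∀ f ∈ F, Measurable f ∧ ∀ x, f x ∈ Set.Icc 0 Vmax) →
      Measurable (Function.uncurry μhat) →
      (∀ w, MBS.IsDensity (lam.prod Measure.count) (μhat w)) →
      -- bounded densities
      M.BoundedDensities lam U →
      -- density estimation error
      MBS.WithProbAtLeast Pw (1 - δ)
        {w | MBS.tvDist (MBS.densityMeasure (lam.prod Measure.count) (μhat w)) μ ≤ εμ} →
      -- completeness of `F` under the filtered Bellman optimality operator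
      (∀ᵐ w ∂Pw, ∀ f ∈ F, ∃ g ∈ F,
        MBS.l2norm μ (fun x => g x - M.bellman (MBS.filter (μhat w) b) f x) ^ 2 ≤ εF) →
      -- the density estimate and the `n` i.i.d. data points are independent
      MBS.WithProbAtLeast (Pw.prod (Measure.pi fun _ : Fin n => M.dataLaw μ)) (1 - 2 * δ)
        {ω | ∀ (t : ℕ) (f : ℕ → S × A → ℝ) (πhat : ℕ → S → A) (hπ : Measurable (πhat t)),
          1 ≤ t →
          M.IsMBSQIRun ω.2 F (MBS.filter (μhat ω.1) b) t f πhat →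
          ∀ πtilde ∈ M.constrainedPolicies (MBS.filter (μhat ω.1) b) εζ,
            M.value πtilde - M.value (MBS.Policy.ofFun (πhat t) hπ) ≤
              2 * (U / b) / (1 - M.γ) ^ 2 *
                (c * √(Vmax ^ 2 * Real.log (F.card / δ) / n) + √εF + Vmax * εμ +
                  MBS.l2norm μ (fun x => M.Q πtilde x -
                    M.bellman (MBS.filter (μhat ω.1) b) (M.Q πtilde) x)) +
              (2 * M.γ ^ t + εζ) * Vmax / (1 - M.γ)} := by
  refine ⟨20, by norm_num, ?_⟩
  intro S A _ _ _ _ M lam _ μ _ Vmax U b δ εμ εF εζ n F W _ Pw _ μhat hn hb hδ hδ1 hV hF hμm hdens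
    hU htv hcomp
  have hA : Nonempty A := by
    obtain ⟨x⟩ := nonempty_of_isProbabilityMeasure μ
    exact ⟨x.2⟩
  have hV0 : 0 ≤ Vmax := by
    obtain ⟨x⟩ := nonempty_of_isProbabilityMeasure μ
    exact (MBS.MDP.meanReward_mem hV x).1.trans (MBS.MDP.meanReward_mem hV x).2
  obtain ⟨G₁, hG₁, hG₁m, hG₁p⟩ := htv
  obtain ⟨N, hN, hNm, hN0⟩ := exists_measurable_superset_of_null (ae_iff.1 hcomp)
  set Pr := Pw.prod (Measure.pi fun _ : Fin n => M.dataLaw μ) with hPr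
  set τ := 20 * √(Vmax ^ 2 * Real.log (F.card / δ) / n) with hτ
  have hRm := MBS.MDP.measurableSet_wellRanked (M := M) (μ := μ) (b := b) (n := n) hμm
    (fun f hf => (hF f hf).1) τ
  have hRp := MBS.MDP.measure_compl_wellRanked_le (μ := μ) (b := b) Pw hV hV0 hμm hF hn hδ hδ1
  set R := M.wellRanked μ F μhat b τ n with hR
  -- The measurable witness: accurate density estimate, completeness (off a null set) and correct
  -- ranking. The first and third events each cost `δ`.
  refine ⟨(Prod.fst ⁻¹' (G₁ ∩ Nᶜ)) ∩ R, ?_, (measurable_fst (hG₁m.inter hNm.compl)).inter hRm, ?_⟩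
  · rintro ω ⟨⟨hω₁, hω₂⟩, hω₃⟩ t f p hp ht hrun π hπ
    have hfF : ∀ i ≤ t, f i ∈ F := by
      intro i hi
      cases i with
      | zero => exact hrun.init
      | succ i => exact hrun.mem i hi
    have hε : ∀ i < t, MBS.l2norm μ (fun x => f (i + 1) x -
        M.bellman (MBS.filter (μhat ω.1) b) (f i) x) ≤ τ + √εF := by
      intro i hi
      have hc : ∀ f ∈ F, ∃ g ∈ F, MBS.l2norm μ (fun x => g x -
          M.bellman (MBS.filter (μhat ω.1) b) f x) ^ 2 ≤ εF := by
        by_contra hc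
        exact hω₂ (hN hc)
      -- Completeness supplies a competitor with error at most `√εF`; the minimizer has no larger
      -- empirical loss, so ranking bounds its error by that of the competitor plus `τ`.
      obtain ⟨g, hg, hgε⟩ := hc (f i) (hfF i hi.le)
      have h1 := Real.le_sqrt_of_sq_le hgε
      have h2 := hω₃ (f (i + 1), g, f i)
        (by simp only [Finset.mem_product]; exact ⟨hfF _ hi, hg, hfF _ hi.le⟩)
      have h3 := MBS.MDP.sum_lossDiff_nonpos_of_empLoss_le hn ω.2 (hrun.argmin i hi g hg)
      have h4 := not_lt.1 fun h => h2 ⟨h, h3⟩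
      simp only at h4
      linarith
    have hU0 := hU.nonneg π
    have hεμ0 : 0 ≤ εμ := (Real.iSup_nonneg fun _ => abs_nonneg _).trans (hG₁ hω₁)
    have hμω : Measurable (μhat ω.1) := hμm.of_uncurry_left
    have hmain := MBS.MDP.value_sub_value_le hV hV0 (MBS.measurable_filter hμω b)
      (MBS.filter_eq_zero_or_one _ b) (by positivity)
      (MBS.MDP.concentrateOn_filter hU0 hb hμω (hdens ω.1) hU (hG₁ hω₁)) (mul_nonneg hV0 hεμ0) ht
      (fun i hi => (hF _ (hfF i hi)).1) (fun i hi => (hF _ (hfF i hi)).2) hε (by positivity) hp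
      (fun s a => by
        have h := hrun.argmax (t - 1) (by omega) s a
        rwa [Nat.sub_add_cancel ht] at h) hπ
    exact hmain
  · have hG₁c : Pw G₁ᶜ ≤ ENNReal.ofReal δ := by
      rw [prob_compl_eq_one_sub hG₁m]
      calc 1 - Pw G₁ ≤ 1 - ENNReal.ofReal (1 - δ) := tsub_le_tsub_left hG₁p 1
        _ = ENNReal.ofReal δ := by
          rw [← ENNReal.ofReal_one, ← ENNReal.ofReal_sub _ (by linarith), sub_sub_cancel]
    have hfst : ∀ B : Set W, MeasurableSet B → Pr (Prod.fst ⁻¹' B) = Pw B := by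
      intro B hB
      exact (measurePreserving_fst (μ := Pw)
        (ν := Measure.pi fun _ : Fin n => M.dataLaw μ)).measure_preimage hB.nullMeasurableSet
    have hGm := (measurable_fst (hG₁m.inter hNm.compl)).inter hRm
    have hc : Pr ((Prod.fst ⁻¹' (G₁ ∩ Nᶜ)) ∩ R)ᶜ ≤ ENNReal.ofReal (2 * δ) := by
      have hsub : ((Prod.fst ⁻¹' (G₁ ∩ Nᶜ)) ∩ R)ᶜ ⊆
          (Prod.fst ⁻¹' G₁ᶜ ∪ Prod.fst ⁻¹' N) ∪ Rᶜ := by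
        intro ω hω
        by_contra h
        simp only [Set.mem_union, Set.mem_preimage, Set.mem_compl_iff, not_or, not_not] at h
        exact hω ⟨⟨h.1.1, h.1.2⟩, h.2⟩
      calc _ ≤ (Pr (Prod.fst ⁻¹' G₁ᶜ) + Pr (Prod.fst ⁻¹' N)) + Pr Rᶜ :=
            (measure_mono hsub).trans ((measure_union_le _ _).trans
              (add_le_add_left (measure_union_le _ _) _))
        _ ≤ (ENNReal.ofReal δ + 0) + ENNReal.ofReal δ := by
            rw [hfst _ hG₁m.compl, hfst _ hNm, hN0]
            gcongr
        _ = ENNReal.ofReal (2 * δ) := by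
            rw [add_zero, ← ENNReal.ofReal_add hδ.le hδ.le, two_mul]
    rw [ENNReal.ofReal_sub _ (by positivity), ENNReal.ofReal_one, tsub_le_iff_right]
    calc (1 : ENNReal) = Pr ((Prod.fst ⁻¹' (G₁ ∩ Nᶜ)) ∩ R) +
          Pr ((Prod.fst ⁻¹' (G₁ ∩ Nᶜ)) ∩ R)ᶜ := (prob_add_prob_compl hGm).symm
      _ ≤ _ := add_le_add_right hc _
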